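/- There is a universal constant $C_2$ such that the following holds. Let $\mathcal H$ be a separable complex Hilbert space and let $T$ be a compact operator on $\mathcal H$. Write $T=H+iK$ with $H,K$ hermitian, that is, $H=\frac12(T+T^*)$ and $K=\frac1{2i}(T-T^*)$, and let $|T|=(T^*T)^{1/2}$. Then $$|\chi(H)-\Re\chi(T)|\le C_2\,\mu(2|T|)\qquad\text{and}\qquad |\chi(K)-\Im\chi(T)|\le C_2\,\mu(2|T|).$$ Here, for a compact operator $S$ on $\mathcal H$ with nonzero eigenvalues $\lambda_1(S),\lambda_2(S),\dots$ repeated according to algebraic multiplicity, $$\chi(S)=\sum_{|\lambda_n(S)|\ge 1}\lambda_n(S),\qquad \mu(S)=\sum_{n}\log_+|\lambda_n(S)|,\qquad \log_+ r=\max(0,\log r).$$ -/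

import Mathlib

noncomputable section

namespace CompactOp

variable {E : Type*} [NormedAddCommGroup E] [InnerProductSpace ℂ E]

/-- The algebraic multiplicity of `z` as an eigenvalue of `T`: the dimension of the space of all
`x` with `(T - z)^k x = 0` for some `k`. It is `0` if `z` is not an eigenvalue, and it is the true
(finite) multiplicity whenever `T` is compact and `z ≠ 0`. -/
def algMult (T : E →L[ℂ] E) (z : ℂ) : ℕ :=
  Module.finrank ℂ (Module.End.maxGenEigenspace (T : E →ₗ[ℂ] E) z)

/-- `χ(T)`: the sum of the eigenvalues of `T` of modulus at least `1`, repeated according to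
algebraic multiplicity. A compact operator has only finitely many such eigenvalues, so that the
sum is finite. -/
def chi (T : E →L[ℂ] E) : ℂ :=
  ∑ᶠ (z : ℂ) (_ : 1 ≤ ‖z‖), (algMult T z : ℂ) * z

/-- `μ(T)`: the sum of `log₊ |z|` over the eigenvalues `z` of `T`, repeated according to
algebraic multiplicity, where `log₊ r = max 0 (log r)`. For a compact operator only finitely many
terms are nonzero (those with `|z| > 1`). -/
def mu (T : E →L[ℂ] E) : ℝ :=
  ∑ᶠ z : ℂ, (algMult T z : ℝ) * Real.posLog ‖z‖

/-- `|T| = (T* T)^{1/2}`, the unique positive square root of `T* T`, through the continuous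
functional calculus. -/
def absOp [CompleteSpace E] (T : E →L[ℂ] E) : E →L[ℂ] E :=
  CFC.sqrt (ContinuousLinearMap.adjoint T * T)

end CompactOp

end

/-!
The two inequalities follow from one fact about a single operator. Suppose that `S = R + D`, where
`‖R‖ ≤ 2 / 3` and `D` has finite rank. Then `χ(S)` differs from the trace of `D` by at most a
constant times `∑ log (1 + 12 s)` over the terms of a singular value expansion of `D`
(`norm_chi_sub_sum_inner_le`). The trace is linear and `tr D* = conj (tr D)`. Truncating the
singular value decomposition of `T` at `2 / 3` (`exists_truncated_svd`) gives such a splitting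
`T = R + D`, and with it splittings of `H = (T + T*) / 2` and `K = (T - T*) / (2 i)`. So `χ(T)`,
`χ(H)` and `χ(K)` are close to `tr D`, `Re (tr D)` and `Im (tr D)`. For singular values `s ≥ 2 / 3`,
`log (1 + 12 s)` is bounded by a multiple of `log (2 s)`, whose sum is at most `μ(2|T|)`.

For the fact about `S`, let `V` be the span of all generalized eigenvectors with eigenvalues of
modulus at least `1`, so that `χ(S)` is the trace of `S` on `V`. Both estimates below rest on the
bound `∏ (1 + 12 s)` for the perturbation determinant `det (1 - G D)`, `‖G‖ ≤ 6`, which is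
Hadamard's inequality for a matrix indexed by the terms of `D` (`norm_det_one_sub_inner_le`).

* On `V`, the maximum principle for a quotient of two characteristic determinants bounds `dim V`
  (`finrank_le_logSize`), as in Jensen's formula. Hence the trace of `R` on `V` is bounded too, and
  `χ(S)` is close to the trace of the compression of `D` to `V`.
* On the orthogonal complement of `V`, the compression of `S` has no eigenvalue outside the open
  unit disc. So `w ↦ det (1 - w (1 - w R)⁻¹ D)`, formed there, has no zero in the unit disc; its
  derivative at `0` is `-tr D`, which the Borel-Carathéodory theorem bounds
  (`norm_sum_inner_le_of_no_eigenvalue`).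
-/

namespace CompactOp

open Module InnerProductSpace
open scoped ComplexConjugate

/-! ### Hadamard's inequality and determinants of perturbations -/

/-- **Hadamard's inequality**, with the rows indexed by `Fin n` for the Gram-Schmidt process. -/
theorem norm_det_le_prod_norm_row_fin {n : ℕ} (M : Matrix (Fin n) (Fin n) ℂ) :
    ‖M.det‖ ≤ ∏ i, ‖WithLp.toLp 2 (M i)‖ := by
  let f : Fin n → EuclideanSpace ℂ (Fin n) := fun i => WithLp.toLp 2 (M i)
  have h : finrank ℂ (EuclideanSpace ℂ (Fin n)) = Fintype.card (Fin n) := by simp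
  let b := gramSchmidtOrthonormalBasis h f
  let e := EuclideanSpace.basisFun (Fin n) ℂ
  have hM : e.toBasis.det f = M.det := by
    rw [Basis.det_apply, ← Matrix.det_transpose]
    congr 1
  have hmul : e.toBasis.det f = e.toBasis.det b * b.toBasis.det f := by
    rw [Basis.det_apply, Basis.det_apply, Basis.det_apply, ← Matrix.det_mul,
      ← OrthonormalBasis.coe_toBasis b, Basis.toMatrix_mul_toMatrix]
  rw [← hM, hmul, norm_mul, OrthonormalBasis.det_to_matrix_orthonormalBasis, one_mul,
    gramSchmidtOrthonormalBasis_det, norm_prod]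
  refine Finset.prod_le_prod (fun _ _ => norm_nonneg _) fun i _ => ?_
  exact (norm_inner_le_norm _ _).trans (by simp [f])

/-- **Hadamard's inequality**: a determinant is at most the product of the Euclidean norms of its
rows. -/
theorem norm_det_le_prod_norm_row {ι : Type*} [Fintype ι] [DecidableEq ι] (M : Matrix ι ι ℂ) :
    ‖M.det‖ ≤ ∏ i, ‖WithLp.toLp 2 (M i)‖ := by
  let e := Fintype.equivFin ι
  rw [← Matrix.det_submatrix_equiv_self e.symm M]
  refine (norm_det_le_prod_norm_row_fin _).trans_eq ?_
  rw [← Equiv.prod_comp e]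
  refine Finset.prod_congr rfl fun i _ => ?_
  rw [EuclideanSpace.norm_eq, EuclideanSpace.norm_eq, ← Equiv.sum_comp e]
  simp

/-- A determinant bound for a finite rank perturbation `∑ ⟪a i, ·⟫ b i` composed with `G`; the
number of terms enters only through the norms of the `a i`. The constant `2` in the Bessel inequality
allows the `b i` to be two orthonormal families together, such as the left and the right singular
vectors of an operator. -/
theorem norm_det_one_sub_inner_le {E ι : Type*} [NormedAddCommGroup E] [InnerProductSpace ℂ E]
    [CompleteSpace E] [Fintype ι] [DecidableEq ι] (a b : ι → E)
    (hb : ∀ y, ∑ j, ‖⟪b j, y⟫_ℂ‖ ^ 2 ≤ 2 * ‖y‖ ^ 2) (G : E →L[ℂ] E) {κ : ℝ} (hG : ‖G‖ ≤ κ) :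
    ‖(1 - Matrix.of fun i j => ⟪a i, G (b j)⟫_ℂ : Matrix ι ι ℂ).det‖ ≤
      ∏ i, (1 + 2 * κ * ‖a i‖) := by
  refine (norm_det_le_prod_norm_row _).trans
    (Finset.prod_le_prod (fun _ _ => norm_nonneg _) fun i _ => ?_)
  have hsplit : WithLp.toLp 2 ((1 - Matrix.of fun i j => ⟪a i, G (b j)⟫_ℂ : Matrix ι ι ℂ) i) =
      EuclideanSpace.single i (1 : ℂ) - WithLp.toLp 2 (fun j => ⟪a i, G (b j)⟫_ℂ) := by
    ext j
    simp [Matrix.one_apply, eq_comm]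
  rw [hsplit]
  refine (norm_sub_le _ _).trans ?_
  have h1 : ‖WithLp.toLp 2 (fun j => ⟪a i, G (b j)⟫_ℂ)‖ ≤ 2 * κ * ‖a i‖ := by
    have hκ : 0 ≤ κ := (norm_nonneg _).trans hG
    refine le_of_sq_le_sq ?_ (by positivity)
    rw [EuclideanSpace.norm_sq_eq]
    have h2 : ∀ j, ‖⟪a i, G (b j)⟫_ℂ‖ = ‖⟪b j, G.adjoint (a i)⟫_ℂ‖ := fun j => by
      rw [← ContinuousLinearMap.adjoint_inner_left, norm_inner_symm]
    simp only [h2]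
    refine (hb _).trans ?_
    have h3 : ‖G.adjoint (a i)‖ ≤ κ * ‖a i‖ :=
      (G.adjoint.le_opNorm _).trans (by
        rw [LinearIsometryEquiv.norm_map]
        gcongr)
    have h4 : ‖G.adjoint (a i)‖ ^ 2 ≤ (κ * ‖a i‖) ^ 2 := by gcongr
    nlinarith [sq_nonneg (κ * ‖a i‖)]
  simpa using h1

/-! ### Determinants depending on a complex parameter -/

theorem differentiableAt_det {ι : Type*} [Fintype ι] [DecidableEq ι] {N : ℂ → Matrix ι ι ℂ} {w : ℂ}
    (hN : ∀ i j, DifferentiableAt ℂ (fun w => N w i j) w) :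
    DifferentiableAt ℂ (fun w => (N w).det) w := by
  simp only [Matrix.det_apply]
  fun_prop

/-- The derivative of `det` along a curve through the identity is the trace. -/
theorem hasDerivAt_det_of_eq_one {ι : Type*} [Fintype ι] [DecidableEq ι] {N : ℂ → Matrix ι ι ℂ}
    {N' : Matrix ι ι ℂ} {w : ℂ} (hw : N w = 1)
    (hN : ∀ i j, HasDerivAt (fun w => N w i j) (N' i j) w) :
    HasDerivAt (fun w => (N w).det) N'.trace w := by
  let d : (ι → ι → ℂ) → ℂ := fun A => (Matrix.of A).det
  have hd : DifferentiableAt ℂ d (N w) := by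
    simp only [d, Matrix.det_apply, Matrix.of_apply]
    fun_prop
  have hline : HasDerivAt (fun t : ℂ => d (fun i j => (1 : Matrix ι ι ℂ) i j + t * N' i j))
      N'.trace 0 := by
    have h : (fun t : ℂ => d (fun i j => (1 : Matrix ι ι ℂ) i j + t * N' i j)) =
        fun t => 1 + N'.trace * t + (Matrix.det (1 + (Polynomial.X : Polynomial ℂ) •
          N'.map Polynomial.C)).divX.divX.eval t * t ^ 2 := by
      funext t
      rw [← Matrix.det_one_add_smul]
      rfl
    rw [h]
    set p := (Matrix.det (1 + (Polynomial.X : Polynomial ℂ) • N'.map Polynomial.C)).divX.divX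
    have h1 := (((hasDerivAt_id (0 : ℂ)).const_mul N'.trace).const_add 1).add
      ((p.hasDerivAt 0).mul ((hasDerivAt_id (0 : ℂ)).pow 2))
    convert! h1 using 1
    simp
  have hcurve : HasDerivAt (fun t : ℂ => (fun i j => (1 : Matrix ι ι ℂ) i j + t * N' i j))
      (fun i j => N' i j) 0 := by
    refine hasDerivAt_pi.2 fun i => hasDerivAt_pi.2 fun j => ?_
    simpa using ((hasDerivAt_id (0 : ℂ)).mul_const (N' i j)).const_add ((1 : Matrix ι ι ℂ) i j)
  have hN1 : HasDerivAt (fun w => (fun i j => N w i j)) (fun i j => N' i j) w :=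
    hasDerivAt_pi.2 fun i => hasDerivAt_pi.2 fun j => hN i j
  have e0 : (fun i j => (1 : Matrix ι ι ℂ) i j + 0 * N' i j) = N w := by
    rw [hw]; funext i j; simp
  have hd0 := hd.hasFDerivAt
  have hc2 := (e0 ▸ hd0 : HasFDerivAt d (fderiv ℂ d (N w))
    ((fun t : ℂ => (fun i j => (1 : Matrix ι ι ℂ) i j + t * N' i j)) 0)).comp_hasDerivAt 0 hcurve
  rw [← hc2.unique hline]
  exact hd0.comp_hasDerivAt w hN1

/-- A Borel-Carathéodory estimate: a zero-free holomorphic function on the unit disc with value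
`1` at the origin and modulus at most `exp M` has derivative at most `4 M` at the origin. -/
theorem norm_deriv_le_of_ne_zero {h : ℂ → ℂ} (hd : DifferentiableOn ℂ h (Metric.ball 0 1))
    (h0 : h 0 = 1) (hne : ∀ w ∈ Metric.ball (0 : ℂ) 1, h w ≠ 0) {M : ℝ} (hM : 0 ≤ M)
    (hle : ∀ w ∈ Metric.ball (0 : ℂ) 1, ‖h w‖ ≤ Real.exp M) {h' : ℂ} (hh' : HasDerivAt h h' 0) :
    ‖h'‖ ≤ 4 * M := by
  have hmem0 : (0 : ℂ) ∈ Metric.ball (0 : ℂ) 1 := by simp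
  have hopen := Metric.isOpen_ball (x := (0 : ℂ)) (ε := 1)
  obtain ⟨g₀, hg₀⟩ := ((hd.deriv hopen).div hd hne).isExactOn_ball
  -- `g` is the branch of `log h` with `g 0 = 0`
  set g : ℂ → ℂ := fun w => g₀ w - g₀ 0 with hgdef
  have hg : ∀ w ∈ Metric.ball (0 : ℂ) 1, HasDerivAt g (deriv h w / h w) w := fun w hw =>
    (hg₀ w hw).sub_const _
  have hg0 : g 0 = 0 := by simp [g]
  have hexp : ∀ w ∈ Metric.ball (0 : ℂ) 1, h w = Complex.exp (g w) := by
    intro w hw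
    have hconst : ∀ z ∈ Metric.ball (0 : ℂ) 1,
        HasDerivAt (fun z => h z * Complex.exp (-g z)) 0 z := by
      intro z hz
      have h1 := ((hd.differentiableAt (hopen.mem_nhds hz)).hasDerivAt).mul (hg z hz).neg.cexp
      convert! h1 using 1
      have := hne z hz
      field_simp
      ring
    have heq := (convex_ball (0 : ℂ) 1).is_const_of_fderivWithin_eq_zero (𝕜 := ℂ)
      (f := fun z => h z * Complex.exp (-g z))
      (fun z hz => (hconst z hz).differentiableAt.differentiableWithinAt)
      (fun z hz => by
        rw [fderivWithin_of_isOpen hopen hz, (hconst z hz).hasFDerivAt.fderiv]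
        ext; simp) hw hmem0
    simp only [hg0, h0, neg_zero, Complex.exp_zero, mul_one, Complex.exp_neg] at heq
    rwa [mul_inv_eq_one₀ (Complex.exp_ne_zero _)] at heq
  have hre : ∀ w ∈ Metric.ball (0 : ℂ) 1, (g w).re ≤ M := by
    intro w hw
    have := hle w hw
    rwa [hexp w hw, Complex.norm_exp, Real.exp_le_exp] at this
  have hg'0 : HasDerivAt g h' 0 := by
    have := hg 0 hmem0
    rwa [h0, div_one, hh'.deriv] at this
  refine le_of_forall_pos_le_add fun δ hδ => ?_
  have hbound : ∀ᶠ z in nhds (0 : ℂ), ‖g z - g 0‖ ≤ (4 * M + δ) * ‖z - 0‖ := by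
    filter_upwards [Metric.ball_mem_nhds (0 : ℂ) (by norm_num : (0 : ℝ) < 1 / 2)] with z hz
    rw [mem_ball_zero_iff] at hz
    have hzb : z ∈ Metric.ball (0 : ℂ) 1 := by rw [mem_ball_zero_iff]; linarith
    have := Complex.borelCaratheodory_zero (M := M + δ / 4) (R := 1) (by positivity)
      (fun w hw => (hg w hw).differentiableAt.differentiableWithinAt)
      (fun w hw => by
        have := hre w hw
        show (g w).re ≤ M + δ / 4
        linarith) one_pos hzb hg0
    rw [hg0, sub_zero, sub_zero]
    refine this.trans ?_
    rw [div_le_iff₀ (by linarith)]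
    have hp : 0 ≤ (4 * M + δ) * ‖z‖ := by positivity
    nlinarith
  exact HasDerivAt.le_of_lip' hg'0 (by positivity) hbound

/-! ### Finite rank operators and their logarithmic size -/

section

variable {ι : Type*} [Fintype ι]

section logSize

variable {E F : Type*} [NormedAddCommGroup E] [NormedAddCommGroup F]


/-- The logarithmic size of a finite rank operator `∑ ⟪a i, ·⟫ b i` whose `b i` satisfy a Bessel
inequality; it takes the place of `∑ log (1 + s)` over the singular values `s`. The factor `12` is
the one that `norm_det_one_sub_inner_le` gives for resolvents `G` with `‖G‖ ≤ 6`. -/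
noncomputable def logSize (a : ι → E) : ℝ := ∑ i, Real.log (1 + 12 * ‖a i‖)

theorem logSize_nonneg (a : ι → E) : 0 ≤ logSize a :=
  Finset.sum_nonneg fun i _ => Real.log_nonneg (by have := norm_nonneg (a i); linarith)

theorem exp_logSize (a : ι → E) : Real.exp (logSize a) = ∏ i, (1 + 12 * ‖a i‖) := by
  rw [logSize, Real.exp_sum]
  refine Finset.prod_congr rfl fun i _ => Real.exp_log ?_
  have := norm_nonneg (a i)
  linarith

theorem logSize_mono {a : ι → E}
    {a' : ι → F} (h : ∀ i, ‖a i‖ ≤ ‖a' i‖) : logSize a ≤ logSize a' :=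
  Finset.sum_le_sum fun i _ => Real.log_le_log (by have := norm_nonneg (a i); linarith)
    (by have := h i; linarith)

end logSize

variable {E : Type*} [NormedAddCommGroup E] [InnerProductSpace ℂ E]

/-- The finite rank operator `x ↦ ∑ i, ⟪a i, x⟫ b i`. -/
noncomputable def finRankOp (a b : ι → E) : E →L[ℂ] E :=
  ∑ i, (innerSL ℂ (a i)).smulRight (b i)

theorem finRankOp_apply (a b : ι → E) (x : E) :
    finRankOp a b x = ∑ i, ⟪a i, x⟫_ℂ • b i := by
  simp [finRankOp]

theorem norm_det_le_exp_logSize [CompleteSpace E] [DecidableEq ι] (a b : ι → E)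
    (hb : ∀ y, ∑ j, ‖⟪b j, y⟫_ℂ‖ ^ 2 ≤ 2 * ‖y‖ ^ 2) (G : E →L[ℂ] E) (hG : ‖G‖ ≤ 6) :
    ‖(1 - Matrix.of fun i j => ⟪a i, G (b j)⟫_ℂ : Matrix ι ι ℂ).det‖ ≤ Real.exp (logSize a) := by
  rw [exp_logSize]
  refine (norm_det_one_sub_inner_le a b hb G hG).trans_eq ?_
  norm_num

/-! ### The trace of the finite rank part in the absence of large eigenvalues -/

theorem isUnit_one_sub_smul [CompleteSpace E] {R : E →L[ℂ] E} (hR : ‖R‖ ≤ 2 / 3) {w : ℂ} (hw : ‖w‖ ≤ 1) :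
    IsUnit (1 - w • R) := by
  refine isUnit_one_sub_of_norm_lt_one ?_
  rw [norm_smul]
  nlinarith [norm_nonneg R, norm_nonneg w]

/-- If `T G = 1` and `T` is bounded below by `c`, then `‖G‖ ≤ c⁻¹`. -/
theorem norm_le_of_comp_eq_one {T G : E →L[ℂ] E} {c : ℝ} (hc : 0 < c)
    (hT : ∀ x, c * ‖x‖ ≤ ‖T x‖) (h : T * G = 1) : ‖G‖ ≤ c⁻¹ := by
  refine ContinuousLinearMap.opNorm_le_bound _ (by positivity) fun y => ?_
  have h1 := hT (G y)
  have h2 : T (G y) = y := by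
    rw [← mul_apply_eq_comp, h, one_apply_eq_self]
  rw [h2] at h1
  rw [inv_mul_eq_div, le_div_iff₀ hc]
  linarith

/-- If `R + finRankOp a b` is a small operator plus a finite rank operator and has no eigenvalue
outside the open unit disc, then the trace of the finite rank part is controlled. The function
`w ↦ det (1 - w (1 - w R)⁻¹ D)` on the unit disc vanishes only at reciprocals of eigenvalues, and
its derivative at the origin is `-tr D`. -/
theorem norm_sum_inner_le_of_no_eigenvalue [CompleteSpace E] {R : E →L[ℂ] E} (hR : ‖R‖ ≤ 2 / 3) (a b : ι → E)
    (hb : ∀ y, ∑ j, ‖⟪b j, y⟫_ℂ‖ ^ 2 ≤ 2 * ‖y‖ ^ 2)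
    (hev : ∀ (c : ℂ) (x : E), 1 ≤ ‖c‖ → R x + finRankOp a b x = c • x → x = 0) :
    ‖∑ i, ⟪a i, b i⟫_ℂ‖ ≤ 4 * logSize a := by
  classical
  let G : ℂ → E →L[ℂ] E := fun w => Ring.inverse (1 - w • R)
  have hG : ∀ w, ‖w‖ ≤ 1 → (1 - w • R) * G w = 1 := fun w hw =>
    Ring.mul_inverse_cancel _ (isUnit_one_sub_smul hR hw)
  have hGn : ∀ w, ‖w‖ ≤ 1 → ‖G w‖ ≤ 3 := by
    intro w hw
    refine (norm_le_of_comp_eq_one (c := 1 / 3) (by norm_num) (fun x => ?_) (hG w hw)).trans_eq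
      (by norm_num)
    have h1 : ‖x‖ ≤ ‖x - w • R x‖ + ‖w • R x‖ := by
      simpa using norm_add_le (x - w • R x) (w • R x)
    have h2 : ‖w • R x‖ ≤ 2 / 3 * ‖x‖ := by
      rw [norm_smul]
      have h3 := (R.le_opNorm x).trans (mul_le_mul_of_nonneg_right hR (norm_nonneg x))
      nlinarith [norm_nonneg w, norm_nonneg (R x)]
    have h4 : (1 - w • R) x = x - w • R x := by simp
    rw [h4]
    linarith
  have hGd : ∀ w, ‖w‖ ≤ 1 → DifferentiableAt ℂ G w := by
    intro w hw
    have h1 : DifferentiableAt ℂ (fun w : ℂ => (1 : E →L[ℂ] E) - w • R) w := by fun_prop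
    exact (differentiableAt_inverse (𝕜 := ℂ) (isUnit_one_sub_smul hR hw)).comp w h1
  let N : ℂ → Matrix ι ι ℂ := fun w => 1 - Matrix.of fun i j => ⟪a i, (w • G w) (b j)⟫_ℂ
  have hNij : ∀ w i j, N w i j = (1 : Matrix ι ι ℂ) i j - w * ⟪a i, G w (b j)⟫_ℂ := by
    intro w i j
    simp [N]
  have hK : ∀ i j w, ‖w‖ ≤ 1 → DifferentiableAt ℂ (fun w => ⟪a i, G w (b j)⟫_ℂ) w := by
    intro i j w hw
    have h1 : DifferentiableAt ℂ (fun w => G w (b j)) w :=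
      (hGd w hw).clm_apply (differentiableAt_const _)
    exact (innerSL ℂ (a i)).differentiableAt.comp w h1
  have hNd : ∀ w, ‖w‖ ≤ 1 → DifferentiableAt ℂ (fun w => (N w).det) w := by
    intro w hw
    refine differentiableAt_det fun i j => ?_
    simp only [hNij]
    exact (differentiableAt_const _).sub (differentiableAt_id.mul (hK i j w hw))
  have hN0 : N 0 = 1 := by
    ext i j
    simp [hNij]
  have hG0 : G 0 = 1 := by simp [G]
  have hderiv : HasDerivAt (fun w => (N w).det)
      (Matrix.of fun i j => -⟪a i, b j⟫_ℂ : Matrix ι ι ℂ).trace 0 := by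
    refine hasDerivAt_det_of_eq_one hN0 fun i j => ?_
    simp only [hNij]
    have h1 := (((hasDerivAt_id (0 : ℂ)).mul (hK i j 0 (by simp)).hasDerivAt).const_sub
      ((1 : Matrix ι ι ℂ) i j))
    convert! h1 using 1
    simp [hG0]
  have hne : ∀ w ∈ Metric.ball (0 : ℂ) 1, (N w).det ≠ 0 := by
    intro w hw h0
    have hw1 : ‖w‖ ≤ 1 := (mem_ball_zero_iff.1 hw).le
    obtain ⟨v, hv, hNv⟩ := Matrix.exists_mulVec_eq_zero_iff.2 h0
    let x : E := w • G w (∑ j, v j • b j)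
    have hvx : ∀ i, v i = ⟪a i, x⟫_ℂ := by
      intro i
      have h1 := congrFun hNv i
      rw [show N w = 1 - Matrix.of fun i j => ⟪a i, (w • G w) (b j)⟫_ℂ from rfl, Matrix.sub_mulVec,
        Matrix.one_mulVec, Pi.sub_apply, Pi.zero_apply, sub_eq_zero] at h1
      rw [h1]
      simp only [x, Matrix.mulVec, dotProduct, Matrix.of_apply, map_sum, map_smul, Finset.smul_sum, inner_sum, inner_smul_right,
        FunLike.coe_smul, Pi.smul_apply]
      exact Finset.sum_congr rfl fun j _ => by ring
    have hDx : finRankOp a b x = ∑ j, v j • b j := by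
      rw [finRankOp_apply]
      exact Finset.sum_congr rfl fun j _ => by rw [hvx j]
    have hx : x - w • R x = w • finRankOp a b x := by
      rw [hDx]
      have h1 := congrArg (fun A : E →L[ℂ] E => A (∑ j, v j • b j)) (hG w hw1)
      simp only [mul_apply_eq_comp, one_apply_eq_self] at h1
      conv_rhs => rw [← h1]
      change w • G w _ - w • R (w • G w _) = _
      generalize G w (∑ j, v j • b j) = y
      simp [smul_sub]
    have hx0 : x ≠ 0 := by
      intro hx0
      exact hv (funext fun i => by rw [hvx i, hx0, inner_zero_right]; rfl)
    have hw0 : w ≠ 0 := by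
      rintro rfl
      exact hx0 (by simp [x])
    refine hx0 (hev w⁻¹ x ?_ ?_)
    · rw [norm_inv]
      exact (one_le_inv₀ (norm_pos_iff.2 hw0)).2 hw1
    · have h1 : x = w • (R x + finRankOp a b x) := by
        rw [smul_add, ← hx]; abel
      conv_rhs => rw [h1]
      rw [smul_smul, inv_mul_cancel₀ hw0, one_smul]
  have hle : ∀ w ∈ Metric.ball (0 : ℂ) 1, ‖(N w).det‖ ≤ Real.exp (logSize a) := by
    intro w hw
    have hw1 : ‖w‖ ≤ 1 := (mem_ball_zero_iff.1 hw).le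
    refine norm_det_le_exp_logSize a b hb _ ?_
    rw [norm_smul]
    nlinarith [hGn w hw1, norm_nonneg w, norm_nonneg (G w)]
  have := norm_deriv_le_of_ne_zero
    (fun w hw => (hNd w (mem_ball_zero_iff.1 hw).le).differentiableWithinAt)
    (by rw [hN0, Matrix.det_one]) hne (logSize_nonneg a) hle hderiv
  simpa [Matrix.trace] using this

/-! ### The number of large eigenvalues -/

theorem toMatrix_finRankOp {n : Type*} [Fintype n] [DecidableEq n] (o : OrthonormalBasis n ℂ E)
    (a b : ι → E) (G : E →L[ℂ] E) :
    LinearMap.toMatrix o.toBasis o.toBasis ((G * finRankOp a b : E →L[ℂ] E) : E →ₗ[ℂ] E) =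
      (Matrix.of fun k i => ⟪o k, G (b i)⟫_ℂ) * (Matrix.of fun i l => ⟪a i, o l⟫_ℂ) := by
  ext k l
  simp [LinearMap.toMatrix_apply, Matrix.mul_apply, finRankOp_apply,
    OrthonormalBasis.repr_apply_apply, mul_comm]

/-- The determinant of a finite rank perturbation of the identity, by the Weinstein-Aronszajn
identity. -/
theorem det_one_sub_finRankOp [FiniteDimensional ℂ E] [DecidableEq ι] (a b : ι → E)
    (G : E →L[ℂ] E) :
    LinearMap.det ((1 - G * finRankOp a b : E →L[ℂ] E) : E →ₗ[ℂ] E) =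
      (1 - Matrix.of fun i j => ⟪a i, G (b j)⟫_ℂ : Matrix ι ι ℂ).det := by
  let o := stdOrthonormalBasis ℂ E
  have h1 : LinearMap.toMatrix o.toBasis o.toBasis
      ((1 - G * finRankOp a b : E →L[ℂ] E) : E →ₗ[ℂ] E) =
      1 - (Matrix.of fun k i => ⟪o k, G (b i)⟫_ℂ) * (Matrix.of fun i l => ⟪a i, o l⟫_ℂ) := by
    rw [← toMatrix_finRankOp o a b G, ← LinearMap.toMatrix_one o.toBasis, ← map_sub]
    rfl
  rw [← LinearMap.det_toMatrix o.toBasis, h1, Matrix.det_one_sub_mul_comm]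
  congr 2
  ext i j
  simp only [Matrix.mul_apply, Matrix.of_apply]
  exact o.sum_inner_mul_inner _ _

theorem one_le_norm_det_of_one_le_eigenvalue [FiniteDimensional ℂ E] {S : End ℂ E}
    (hS : ∀ c, S.HasEigenvalue c → 1 ≤ ‖c‖) : 1 ≤ ‖LinearMap.det S‖ := by
  rw [Module.End.det_eq_prod_roots_charpoly_of_splits (IsAlgClosed.splits _)]
  have h : ∀ s : Multiset ℂ, (∀ c ∈ s, 1 ≤ ‖c‖) → 1 ≤ ‖s.prod‖ := by
    intro s
    induction s using Multiset.induction_on with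
    | empty => simp
    | cons c s ih =>
      intro h
      rw [Multiset.prod_cons, norm_mul]
      have h1 := h c (Multiset.mem_cons_self c s)
      have h2 := ih fun d hd => h d (Multiset.mem_cons_of_mem hd)
      nlinarith
  refine h _ fun c hc => hS c ?_
  rw [Module.End.hasEigenvalue_iff_isRoot_charpoly]
  exact (Polynomial.mem_roots'.1 hc).2

/-- If all eigenvalues of `R + finRankOp a b` on a finite-dimensional space lie outside the open
unit disc, where `R` is small, then the dimension is controlled by the finite rank part. This is
the maximum principle on the disc of radius `r = 5 / 6` for
`det (z - S) / det (r ^ 2 - z R*)`: the denominator has modulus `r ^ n |det (z - R)|` on the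
boundary circle, and value `r ^ (2 n)` at the origin. -/
theorem finrank_le_logSize [FiniteDimensional ℂ E] {R : E →L[ℂ] E} (hR : ‖R‖ ≤ 2 / 3) (a b : ι → E)
    (hb : ∀ y, ∑ j, ‖⟪b j, y⟫_ℂ‖ ^ 2 ≤ 2 * ‖y‖ ^ 2)
    (hev : ∀ c, End.HasEigenvalue ((R + finRankOp a b : E →L[ℂ] E) : End ℂ E) c → 1 ≤ ‖c‖) :
    (finrank ℂ E : ℝ) ≤ 6 * logSize a := by
  classical
  have : CompleteSpace E := FiniteDimensional.complete ℂ E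
  set S : E →L[ℂ] E := R + finRankOp a b with hSdef
  let o := stdOrthonormalBasis ℂ E
  set n := finrank ℂ E with hn
  set MS := LinearMap.toMatrix o.toBasis o.toBasis (S : E →ₗ[ℂ] E) with hMS
  set MR := LinearMap.toMatrix o.toBasis o.toBasis (R : E →ₗ[ℂ] E) with hMR
  have hdet : ∀ (z c : ℂ) (A : E →L[ℂ] E), (z • (1 : Matrix (Fin n) (Fin n) ℂ) -
      c • LinearMap.toMatrix o.toBasis o.toBasis (A : E →ₗ[ℂ] E)).det =
      LinearMap.det ((z • (1 : E →L[ℂ] E) - c • A : E →L[ℂ] E) : E →ₗ[ℂ] E) := by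
    intro z c A
    rw [← LinearMap.det_toMatrix o.toBasis, ← LinearMap.toMatrix_one o.toBasis, ← map_smul,
      ← map_smul, ← map_sub]
    rfl
  -- `z - c R` is bounded below by `|z| - 2 / 3 * |c|`
  have hlow : ∀ (z c : ℂ) (δ : ℝ), δ ≤ ‖z‖ - ‖c‖ * (2 / 3) → ∀ x : E,
      δ * ‖x‖ ≤ ‖(z • (1 : E →L[ℂ] E) - c • R) x‖ := by
    intro z c δ h x
    have h4 : (z • (1 : E →L[ℂ] E) - c • R) x = z • x - c • R x := by simp
    have h1 : ‖z • x‖ ≤ ‖z • x - c • R x‖ + ‖c • R x‖ := by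
      simpa using norm_add_le (z • x - c • R x) (c • R x)
    have h3 := (R.le_opNorm x).trans (mul_le_mul_of_nonneg_right hR (norm_nonneg x))
    have h5 : ‖c‖ * ‖R x‖ ≤ ‖c‖ * (2 / 3 * ‖x‖) := by gcongr
    rw [norm_smul, norm_smul] at h1
    rw [h4]
    nlinarith [norm_nonneg x]
  have hunit : ∀ (z c : ℂ) (δ : ℝ), 0 < δ → δ ≤ ‖z‖ - ‖c‖ * (2 / 3) →
      LinearMap.det ((z • (1 : E →L[ℂ] E) - c • R : E →L[ℂ] E) : E →ₗ[ℂ] E) ≠ 0 := by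
    intro z c δ hδ h h0
    obtain ⟨x, hx, hx0⟩ := (Submodule.ne_bot_iff _).1 (LinearMap.bot_lt_ker_of_det_eq_zero h0).ne'
    have h1 := hlow z c δ h x
    have h2 : (z • (1 : E →L[ℂ] E) - c • R) x = 0 := hx
    rw [h2, norm_zero] at h1
    have := norm_pos_iff.2 hx0
    nlinarith
  let p : ℂ → ℂ := fun z => (z • (1 : Matrix (Fin n) (Fin n) ℂ) - (1 : ℂ) • MS).det
  let q : ℂ → ℂ := fun z =>
    (((5 / 6 : ℂ) ^ 2) • (1 : Matrix (Fin n) (Fin n) ℂ) - z • MR.conjTranspose).det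
  have hpd : Differentiable ℂ p := fun z => differentiableAt_det fun i j => by
    simp only [Matrix.sub_apply, Matrix.smul_apply, smul_eq_mul]; fun_prop
  have hqd : Differentiable ℂ q := fun z => differentiableAt_det fun i j => by
    simp only [Matrix.sub_apply, Matrix.smul_apply, smul_eq_mul]; fun_prop
  -- the adjoint of `R` enters through the conjugate transpose, so `q` is a conjugated determinant
  have hqconj : ∀ z, q z = conj
      ((((5 / 6 : ℂ) ^ 2) • (1 : Matrix (Fin n) (Fin n) ℂ) - conj z • MR).det) := by
    intro z
    rw [starRingEnd_apply, ← Matrix.det_conjTranspose]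
    simp only [q, Matrix.conjTranspose_sub, Matrix.conjTranspose_smul, Matrix.conjTranspose_one]
    congr 2
    · simp
    · simp
  have hq0 : ∀ z ∈ Metric.closedBall (0 : ℂ) (5 / 6), q z ≠ 0 := by
    intro z hz
    rw [mem_closedBall_zero_iff] at hz
    rw [hqconj, hMR, hdet]
    refine (map_ne_zero _).2 (hunit _ _ (5 / 36) (by norm_num) ?_)
    rw [RCLike.norm_conj]
    norm_num
    linarith
  have hbd : ∀ z ∈ Metric.sphere (0 : ℂ) (5 / 6),
      ‖p z / q z‖ ≤ ((5 / 6 : ℝ) ^ n)⁻¹ * Real.exp (logSize a) := by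
    intro z hz
    rw [mem_sphere_zero_iff_norm] at hz
    have hδ : (1 / 6 : ℝ) ≤ ‖z‖ - ‖(1 : ℂ)‖ * (2 / 3) := by rw [hz]; norm_num
    have hzz : z * conj z = (5 / 6 : ℂ) ^ 2 := by
      rw [Complex.mul_conj, Complex.normSq_eq_norm_sq, hz]; norm_num
    have hq : ‖q z‖ = (5 / 6 : ℝ) ^ n *
        ‖LinearMap.det ((z • (1 : E →L[ℂ] E) - (1 : ℂ) • R : E →L[ℂ] E) : E →ₗ[ℂ] E)‖ := by
      have h1 : ((5 / 6 : ℂ) ^ 2) • (1 : Matrix (Fin n) (Fin n) ℂ) - conj z • MR =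
          conj z • (z • (1 : Matrix (Fin n) (Fin n) ℂ) - (1 : ℂ) • MR) := by
        rw [← hzz, smul_sub, smul_smul, mul_comm z, one_smul]
      rw [hqconj, h1, Matrix.det_smul, RCLike.norm_conj, norm_mul, norm_pow, RCLike.norm_conj, hz,
        hMR, hdet, Fintype.card_fin]
    -- on the circle, `G = (z - R)⁻¹` has norm at most `(5 / 6 - 2 / 3)⁻¹ = 6`
    have hdet0 := hunit z 1 (1 / 6) (by norm_num) hδ
    let e := LinearEquiv.ofIsUnitDet (f := ((z • (1 : E →L[ℂ] E) - (1 : ℂ) • R : E →L[ℂ] E) :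
      E →ₗ[ℂ] E)) (v := o.toBasis) (v' := o.toBasis)
      (by rw [LinearMap.det_toMatrix]; exact isUnit_iff_ne_zero.2 hdet0)
    let G : E →L[ℂ] E := LinearMap.toContinuousLinearMap (e.symm : E →ₗ[ℂ] E)
    have hTG : (z • (1 : E →L[ℂ] E) - (1 : ℂ) • R) * G = 1 := by
      ext x
      exact e.apply_symm_apply x
    have hG : ‖G‖ ≤ 6 :=
      (norm_le_of_comp_eq_one (by norm_num) (hlow z 1 (1 / 6) hδ) hTG).trans_eq (by norm_num)
    have hp : p z = LinearMap.det ((z • (1 : E →L[ℂ] E) - (1 : ℂ) • R : E →L[ℂ] E) : E →ₗ[ℂ] E) *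
        (1 - Matrix.of fun i j => ⟪a i, G (b j)⟫_ℂ : Matrix ι ι ℂ).det := by
      rw [← det_one_sub_finRankOp, ← LinearMap.det_comp]
      simp only [p, hMS, hdet]
      congr 1
      have h2 : (z • (1 : E →L[ℂ] E) - (1 : ℂ) • S) =
          (z • (1 : E →L[ℂ] E) - (1 : ℂ) • R) * (1 - G * finRankOp a b) := by
        rw [mul_sub, ← mul_assoc, hTG, hSdef]
        simp only [one_smul, mul_one, one_mul]
        abel
      rw [h2]
      rfl
    rw [norm_div, hq, hp, norm_mul]
    have hpos := norm_pos_iff.2 hdet0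
    rw [mul_comm, mul_div_mul_right _ _ hpos.ne', div_eq_inv_mul]
    gcongr
    exact norm_det_le_exp_logSize a b hb G hG
  have hmax : ‖p 0 / q 0‖ ≤ ((5 / 6 : ℝ) ^ n)⁻¹ * Real.exp (logSize a) := by
    refine Complex.norm_le_of_forall_mem_frontier_norm_le
      (U := Metric.ball (0 : ℂ) (5 / 6)) (f := fun z => p z / q z) Metric.isBounded_ball ?_ ?_ ?_
    · refine DifferentiableOn.diffContOnCl fun z hz => ?_
      rw [closure_ball _ (by norm_num)] at hz
      exact ((hpd z).div (hqd z) (hq0 z hz)).differentiableWithinAt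
    · rw [frontier_ball _ (by norm_num)]
      exact hbd
    · exact subset_closure (by simp)
  have hp0 : 1 ≤ ‖p 0‖ := by
    have h1 : p 0 = (-1) ^ n * LinearMap.det (S : E →ₗ[ℂ] E) := by
      simp only [p, zero_smul, zero_sub, one_smul]
      rw [Matrix.det_neg, Fintype.card_fin, hMS, LinearMap.det_toMatrix]
    rw [h1, norm_mul, norm_pow, norm_neg, norm_one, one_pow, one_mul]
    exact one_le_norm_det_of_one_le_eigenvalue hev
  have hqz : ‖q 0‖ = (5 / 6 : ℝ) ^ n * (5 / 6 : ℝ) ^ n := by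
    simp only [q, zero_smul, sub_zero]
    rw [Matrix.det_smul, Matrix.det_one, Fintype.card_fin, mul_one, norm_pow, norm_pow]
    norm_num
    rw [← mul_pow]
    norm_num
  have hpow : ((6 / 5 : ℝ)) ^ n ≤ Real.exp (logSize a) := by
    have hr : (0 : ℝ) < (5 / 6 : ℝ) ^ n := by positivity
    rw [norm_div, hqz, div_le_iff₀ (by positivity)] at hmax
    have h1 : 1 ≤ Real.exp (logSize a) * (5 / 6 : ℝ) ^ n := by
      refine hp0.trans (hmax.trans_eq ?_)
      field_simp
    have h2 : (6 / 5 : ℝ) ^ n * (5 / 6 : ℝ) ^ n = 1 := by rw [← mul_pow]; norm_num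
    have h3 : (0 : ℝ) < (6 / 5 : ℝ) ^ n := by positivity
    nlinarith
  have hlog : (n : ℝ) * Real.log (6 / 5) ≤ logSize a := by
    have := Real.log_le_log (by positivity) hpow
    rwa [Real.log_pow, Real.log_exp] at this
  have hl : (1 / 6 : ℝ) ≤ Real.log (6 / 5) := by
    have := Real.one_sub_inv_le_log_of_pos (x := 6 / 5) (by norm_num)
    norm_num at this ⊢
    linarith
  have hn0 : (0 : ℝ) ≤ n := Nat.cast_nonneg n
  nlinarith

end

section

variable {E : Type*} [NormedAddCommGroup E] [InnerProductSpace ℂ E]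
variable {ι : Type*} [Fintype ι]

/-! ### Compressions to subspaces -/

/-- The compression `P A P` of `A` to the subspace `U`, as an operator on `U`. -/
noncomputable def compress (U : Submodule ℂ E) [U.HasOrthogonalProjection] (A : E →L[ℂ] E) :
    U →L[ℂ] U :=
  U.orthogonalProjectionOnto ∘L A ∘L U.subtypeL

section compress

variable (U : Submodule ℂ E) [U.HasOrthogonalProjection]

theorem compress_apply (A : E →L[ℂ] E) (x : U) :
    compress U A x = U.orthogonalProjectionOnto (A x) := rfl

theorem compress_add (A B : E →L[ℂ] E) : compress U (A + B) = compress U A + compress U B := by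
  ext x
  simp [compress_apply]

theorem norm_compress_le (A : E →L[ℂ] E) : ‖compress U A‖ ≤ ‖A‖ := by
  refine ContinuousLinearMap.opNorm_le_bound _ (norm_nonneg _) fun x => ?_
  rw [compress_apply]
  exact (U.norm_orthogonalProjectionOnto_apply_le _).trans (A.le_opNorm _)

theorem compress_finRankOp (a b : ι → E) :
    compress U (finRankOp a b) =
      finRankOp (fun i => U.orthogonalProjectionOnto (a i)) (fun i => U.orthogonalProjectionOnto (b i)) := by
  ext x
  simp [compress_apply, finRankOp_apply]

theorem sum_norm_inner_orthogonalProjection_le {b : ι → E}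
    (hb : ∀ y, ∑ j, ‖⟪b j, y⟫_ℂ‖ ^ 2 ≤ 2 * ‖y‖ ^ 2) (y : U) :
    ∑ j, ‖⟪U.orthogonalProjectionOnto (b j), y⟫_ℂ‖ ^ 2 ≤ 2 * ‖y‖ ^ 2 := by
  simpa using hb y

theorem logSize_orthogonalProjection_le (a : ι → E) :
    logSize (fun i => U.orthogonalProjectionOnto (a i)) ≤ logSize a :=
  logSize_mono fun i => U.norm_orthogonalProjectionOnto_apply_le (a i)

theorem coe_compress_of_invariant {A : E →L[ℂ] E} (hU : ∀ x ∈ U, A x ∈ U) (x : U) :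
    (compress U A x : E) = A x := by
  rw [compress_apply, ← Submodule.starProjection_apply,
    Submodule.starProjection_eq_self_iff.2 (hU x x.2)]

end compress

/-! ### The spectral subspace of the large eigenvalues -/

/-- The span of all generalized eigenvectors of `S` with eigenvalue outside the open unit disc. -/
def largeSpace (S : End ℂ E) : Submodule ℂ E :=
  ⨆ z : {z : ℂ // 1 ≤ ‖z‖}, S.maxGenEigenspace z

theorem maxGenEigenspace_le_largeSpace (S : End ℂ E) {z : ℂ} (hz : 1 ≤ ‖z‖) :
    S.maxGenEigenspace z ≤ largeSpace S :=
  le_iSup (fun z : {z : ℂ // 1 ≤ ‖z‖} => S.maxGenEigenspace z) ⟨z, hz⟩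

theorem apply_mem_maxGenEigenspace (S : End ℂ E) (z c : ℂ) {x : E}
    (hx : x ∈ S.maxGenEigenspace z) : (S - c • (1 : End ℂ E)) x ∈ S.maxGenEigenspace z :=
  End.mapsTo_maxGenEigenspace_of_comm
    ((Commute.refl S).sub_right ((Commute.one_right S).smul_right c)) z hx

theorem apply_mem_largeSpace (S : End ℂ E) {x : E} (hx : x ∈ largeSpace S) :
    S x ∈ largeSpace S := by
  refine Submodule.iSup_induction (fun z : {z : ℂ // 1 ≤ ‖z‖} => S.maxGenEigenspace z)
    (motive := fun x => S x ∈ largeSpace S) hx (fun z x hx => ?_) (by simp)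
    (fun x y hx hy => by rw [map_add]; exact add_mem hx hy)
  have h := apply_mem_maxGenEigenspace S z 0 hx
  rw [zero_smul, sub_zero] at h
  exact maxGenEigenspace_le_largeSpace S z.2 h

/-- Eigenvectors in the spectral subspace have large eigenvalues, because the generalized
eigenspaces are independent. -/
theorem one_le_norm_of_mem_largeSpace {S : End ℂ E} {c : ℂ} {x : E} (hx : x ∈ largeSpace S)
    (hx0 : x ≠ 0) (hS : S x = c • x) : 1 ≤ ‖c‖ := by
  by_contra hc
  have h1 : x ∈ S.maxGenEigenspace c :=
    End.mem_maxGenEigenspace S c x |>.2 ⟨1, by simp [hS]⟩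
  have h2 : largeSpace S ≤ ⨆ z, ⨆ (_ : z ≠ c), S.maxGenEigenspace z :=
    iSup_le fun z => le_iSup₂_of_le z.1 (fun h => hc (h ▸ z.2)) le_rfl
  exact hx0 (Submodule.disjoint_def.1 (S.independent_maxGenEigenspace c) x h1 (h2 hx))

/-- Every generalized eigenvector lies in a finite-dimensional invariant subspace. -/
theorem exists_finiteDimensional_invariant (S : End ℂ E) (z : ℂ) {x : E}
    (hx : x ∈ S.maxGenEigenspace z) :
    ∃ U : Submodule ℂ E, FiniteDimensional ℂ U ∧ U ≤ S.maxGenEigenspace z ∧ (∀ y ∈ U, S y ∈ U) ∧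
      x ∈ U := by
  obtain ⟨k, hk⟩ := (End.mem_maxGenEigenspace S z x).1 hx
  set N : End ℂ E := S - z • 1 with hN
  let v : ℕ → E := fun j => (N ^ j) x
  have hfin : (Set.range v).Finite := by
    refine ((Finset.range (k + 1)).finite_toSet.image v).subset ?_
    rintro _ ⟨j, rfl⟩
    rcases le_or_gt j k with h | h
    · exact ⟨j, by simpa using Nat.lt_succ_of_le h, rfl⟩
    · refine ⟨k, by simp, ?_⟩
      have h1 : v j = (N ^ (j - k)) ((N ^ k) x) := by
        rw [← Module.End.mul_apply, ← pow_add, Nat.sub_add_cancel h.le]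
      rw [h1, hk, map_zero]
      exact hk
  have hstep : ∀ y ∈ Submodule.span ℂ (Set.range v), N y ∈ Submodule.span ℂ (Set.range v) := by
    intro y hy
    induction hy using Submodule.span_induction with
    | mem y hy =>
      obtain ⟨j, rfl⟩ := hy
      refine Submodule.subset_span ⟨j + 1, ?_⟩
      simp only [v]
      rw [pow_succ', Module.End.mul_apply]
    | zero => simp
    | add y₁ y₂ _ _ h₁ h₂ => rw [map_add]; exact add_mem h₁ h₂
    | smul c y _ h => rw [map_smul]; exact Submodule.smul_mem _ c h
  refine ⟨Submodule.span ℂ (Set.range v), FiniteDimensional.span_of_finite ℂ hfin, ?_, ?_,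
    Submodule.subset_span ⟨0, by simp [v]⟩⟩
  · rw [Submodule.span_le]
    rintro _ ⟨j, rfl⟩
    induction j with
    | zero => simpa [v] using hx
    | succ j ih =>
      simp only [v] at ih ⊢
      rw [pow_succ', Module.End.mul_apply]
      exact apply_mem_maxGenEigenspace S z z ih
  · intro y hy
    have h1 : S y = N y + z • y := by simp [hN]
    rw [h1]
    exact add_mem (hstep y hy) (Submodule.smul_mem _ z hy)

theorem finrank_le_of_le_largeSpace {R : E →L[ℂ] E} (hR : ‖R‖ ≤ 2 / 3) (a b : ι → E)
    (hb : ∀ y, ∑ j, ‖⟪b j, y⟫_ℂ‖ ^ 2 ≤ 2 * ‖y‖ ^ 2) (U : Submodule ℂ E) [FiniteDimensional ℂ U]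
    (hinv : ∀ x ∈ U, (R + finRankOp a b) x ∈ U)
    (hU : U ≤ largeSpace ((R + finRankOp a b : E →L[ℂ] E) : End ℂ E)) :
    (finrank ℂ U : ℝ) ≤ 6 * logSize a := by
  have h := finrank_le_logSize ((norm_compress_le U R).trans hR)
    (fun i => U.orthogonalProjectionOnto (a i)) (fun i => U.orthogonalProjectionOnto (b i))
    (sum_norm_inner_orthogonalProjection_le U hb) (fun c hc => ?_)
  · exact h.trans (by have := logSize_orthogonalProjection_le U a; linarith)
  · rw [← compress_finRankOp, ← compress_add] at hc
    obtain ⟨x, hx, hx0⟩ := hc.exists_hasEigenvector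
    rw [End.mem_eigenspace_iff] at hx
    refine one_le_norm_of_mem_largeSpace (hU x.2) (by simpa using hx0) ?_
    have h1 := congrArg (Subtype.val) hx
    have h2 := coe_compress_of_invariant U hinv x
    exact h2.symm.trans h1

/-- The spectral subspace of the large eigenvalues is finite-dimensional: all its
finite-dimensional invariant subspaces have bounded dimension, and one of maximal dimension
contains all generalized eigenvectors. -/
theorem finiteDimensional_largeSpace {R : E →L[ℂ] E} (hR : ‖R‖ ≤ 2 / 3) (a b : ι → E)
    (hb : ∀ y, ∑ j, ‖⟪b j, y⟫_ℂ‖ ^ 2 ≤ 2 * ‖y‖ ^ 2) :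
    FiniteDimensional ℂ (largeSpace ((R + finRankOp a b : E →L[ℂ] E) : End ℂ E)) := by
  set S : E →L[ℂ] E := R + finRankOp a b with hS
  let good : Submodule ℂ E → Prop := fun U => FiniteDimensional ℂ U ∧ (∀ x ∈ U, S x ∈ U) ∧
    U ≤ largeSpace (S : End ℂ E)
  -- the dimensions of the good subspaces, bounded by `finrank_le_of_le_largeSpace`
  let s : Set ℕ := {n | ∃ U, good U ∧ finrank ℂ U = n}
  have hs : BddAbove s := by
    refine ⟨⌊6 * logSize a⌋₊, ?_⟩
    rintro _ ⟨U, ⟨hU, hinv, hle⟩, rfl⟩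
    exact Nat.le_floor (finrank_le_of_le_largeSpace hR a b hb U hinv hle)
  have hbot : good ⊥ := ⟨inferInstance, by simp, bot_le⟩
  obtain ⟨U, hU, hUn⟩ := Nat.sSup_mem (s := s) ⟨_, ⊥, hbot, rfl⟩ hs
  have hUfd := hU.1
  have hle : largeSpace (S : End ℂ E) ≤ U := by
    refine iSup_le fun z x hx => ?_
    obtain ⟨U', hU', hle', hinv', hxU'⟩ := exists_finiteDimensional_invariant _ _ hx
    have hgood : good (U ⊔ U') := by
      refine ⟨inferInstance, fun y hy => ?_,
        sup_le hU.2.2 (hle'.trans (maxGenEigenspace_le_largeSpace _ z.2))⟩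
      obtain ⟨y₁, h₁, y₂, h₂, rfl⟩ := Submodule.mem_sup.1 hy
      rw [map_add]
      exact Submodule.add_mem_sup (hU.2.1 _ h₁) (hinv' _ h₂)
    have h1 : finrank ℂ (U ⊔ U' : Submodule ℂ E) ≤ finrank ℂ U := by
      rw [hUn]
      exact le_csSup hs ⟨_, hgood, rfl⟩
    rw [Submodule.eq_of_le_of_finrank_le le_sup_left h1]
    exact Submodule.mem_sup_right hxU'
  exact Submodule.finiteDimensional_of_le hle

/-- Modulo the spectral subspace of the large eigenvalues there are no large eigenvalues left. -/
theorem mem_largeSpace_of_apply_sub_mem {S : End ℂ E} [FiniteDimensional ℂ (largeSpace S)]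
    {c : ℂ} (hc : 1 ≤ ‖c‖) {x : E} (hx : (S - c • (1 : End ℂ E)) x ∈ largeSpace S) :
    x ∈ largeSpace S := by
  -- modulo the generalized eigenspace of `c`, the map `S - c` is onto on the spectral subspace
  have key : ∀ y ∈ largeSpace S, ∃ r ∈ largeSpace S,
      y - (S - c • (1 : End ℂ E)) r ∈ S.maxGenEigenspace c := by
    intro y hy
    refine Submodule.iSup_induction (fun z : {z : ℂ // 1 ≤ ‖z‖} => S.maxGenEigenspace z)
      (motive := fun y => ∃ r ∈ largeSpace S, y - (S - c • (1 : End ℂ E)) r ∈ S.maxGenEigenspace c)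
      hy (fun z y hy => ?_) ⟨0, by simp, by simp⟩ ?_
    · rcases eq_or_ne (z : ℂ) c with rfl | hzc
      · exact ⟨0, by simp, by simpa using hy⟩
      · have : FiniteDimensional ℂ (S.maxGenEigenspace (z : ℂ)) :=
          Submodule.finiteDimensional_of_le (maxGenEigenspace_le_largeSpace S z.2)
        let f : End ℂ (S.maxGenEigenspace (z : ℂ)) := (S - c • (1 : End ℂ E)).restrict
          (fun _ h => apply_mem_maxGenEigenspace S z c h)
        have hinj : Function.Injective f := by
          rw [← LinearMap.ker_eq_bot, LinearMap.ker_eq_bot']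
          intro r hr
          have h1 : (S - c • (1 : End ℂ E)) (r : E) = 0 := congrArg Subtype.val hr
          have h2 : (r : E) ∈ S.maxGenEigenspace c :=
            (End.mem_maxGenEigenspace S c _).2 ⟨1, by simpa using h1⟩
          have h3 := S.independent_maxGenEigenspace.pairwiseDisjoint hzc
          exact Subtype.ext (Submodule.disjoint_def.1 h3 _ r.2 h2)
        obtain ⟨r, hr⟩ := LinearMap.surjective_of_injective hinj ⟨y, hy⟩
        refine ⟨r, maxGenEigenspace_le_largeSpace S z.2 r.2, ?_⟩
        have h1 : (S - c • (1 : End ℂ E)) (r : E) = y := congrArg Subtype.val hr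
        rw [h1, sub_self]
        exact zero_mem _
    · rintro y₁ y₂ ⟨r₁, h₁, h₁'⟩ ⟨r₂, h₂, h₂'⟩
      refine ⟨r₁ + r₂, add_mem h₁ h₂, ?_⟩
      rw [map_add, add_sub_add_comm]
      exact add_mem h₁' h₂'
  obtain ⟨r, hr, hr'⟩ := key _ hx
  rw [← map_sub] at hr'
  obtain ⟨k, hk⟩ := (End.mem_maxGenEigenspace S c _).1 hr'
  have h1 : x - r ∈ S.maxGenEigenspace c := by
    refine (End.mem_maxGenEigenspace S c _).2 ⟨k + 1, ?_⟩
    rw [pow_succ, Module.End.mul_apply]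
    exact hk
  have h2 := add_mem (maxGenEigenspace_le_largeSpace S hc h1) hr
  rwa [sub_add_cancel] at h2

/-- `χ(S)` is the trace of `S` on the spectral subspace of its large eigenvalues. -/
theorem chi_eq_trace (S : E →L[ℂ] E) [FiniteDimensional ℂ (largeSpace (S : End ℂ E))] :
    chi S = LinearMap.trace ℂ (largeSpace (S : End ℂ E))
      (compress (largeSpace (S : End ℂ E)) S : End ℂ (largeSpace (S : End ℂ E))) := by
  classical
  set V := largeSpace (S : End ℂ E) with hV
  have hinv : ∀ x ∈ V, (S : End ℂ E) x ∈ V := fun x hx => apply_mem_largeSpace _ hx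
  set f : End ℂ V := (compress V S : End ℂ V) with hf
  have hfr : f = (S : End ℂ E).restrict hinv := by
    ext x
    exact coe_compress_of_invariant V hinv x
  have hmult : ∀ z : ℂ, 1 ≤ ‖z‖ → algMult S z = f.charpoly.rootMultiplicity z := by
    intro z hz
    rw [← LinearMap.finrank_maxGenEigenspace_eq, algMult]
    have h1 := Submodule.inf_genEigenspace (S : End ℂ E) V (k := ⊤) (μ := z) hinv
    rw [inf_eq_right.2 (maxGenEigenspace_le_largeSpace _ hz), ← hfr] at h1
    change finrank ℂ (End.genEigenspace (S : End ℂ E) z ⊤) = finrank ℂ (End.genEigenspace f z ⊤)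
    change End.genEigenspace (S : End ℂ E) z ⊤ = _ at h1
    rw [h1]
    exact Submodule.finrank_map_subtype_eq V _
  have hsmall : ∀ z : ℂ, z ∈ f.charpoly.roots → 1 ≤ ‖z‖ := by
    intro z hz
    have h1 : f.HasEigenvalue z := by
      rw [Module.End.hasEigenvalue_iff_isRoot_charpoly]
      exact (Polynomial.mem_roots'.1 hz).2
    obtain ⟨x, hx, hx0⟩ := h1.exists_hasEigenvector
    rw [End.mem_eigenspace_iff, hfr] at hx
    exact one_le_norm_of_mem_largeSpace x.2 (by simpa using hx0) (congrArg Subtype.val hx)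
  rw [Module.End.trace_eq_sum_roots_charpoly_of_splits (IsAlgClosed.splits _),
    Finset.sum_multiset_count, chi]
  have hterm : ∀ z : ℂ, (∑ᶠ (_ : 1 ≤ ‖z‖), (algMult S z : ℂ) * z) =
      f.charpoly.roots.count z • z := by
    intro z
    by_cases hz : 1 ≤ ‖z‖
    · rw [finsum_eq_if, if_pos hz, hmult z hz, Polynomial.count_roots, nsmul_eq_mul]
    · rw [finsum_eq_if, if_neg hz, Multiset.count_eq_zero_of_notMem (fun h => hz (hsmall z h)),
        zero_smul]
  simp only [hterm]
  refine finsum_eq_sum_of_support_subset _ fun z hz => ?_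
  rw [Finset.mem_coe, Multiset.mem_toFinset]
  by_contra h
  exact hz (by simp [Multiset.count_eq_zero_of_notMem h])

/-! ### The sum of the large eigenvalues and the trace of the finite rank part -/

theorem trace_compress_finRankOp (U : Submodule ℂ E) [FiniteDimensional ℂ U] (a b : ι → E) :
    LinearMap.trace ℂ U (compress U (finRankOp a b) : End ℂ U) =
      ∑ i, ⟪U.orthogonalProjectionOnto (a i), U.orthogonalProjectionOnto (b i)⟫_ℂ := by
  rw [LinearMap.trace_eq_sum_inner _ (stdOrthonormalBasis ℂ U)]
  simp only [compress_finRankOp, ContinuousLinearMap.coe_coe, finRankOp_apply, inner_sum,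
    inner_smul_right]
  rw [Finset.sum_comm]
  exact Finset.sum_congr rfl fun i _ => OrthonormalBasis.sum_inner_mul_inner _ _ _

theorem norm_trace_le {F : Type*} [NormedAddCommGroup F] [InnerProductSpace ℂ F]
    [FiniteDimensional ℂ F] (A : F →L[ℂ] F) :
    ‖LinearMap.trace ℂ F (A : End ℂ F)‖ ≤ finrank ℂ F * ‖A‖ := by
  let o := stdOrthonormalBasis ℂ F
  rw [LinearMap.trace_eq_sum_inner _ o]
  refine (norm_sum_le_of_le (n := fun _ => ‖A‖) _ fun i _ => ?_).trans (by simp)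
  refine (norm_inner_le_norm _ _).trans ?_
  have h := A.le_opNorm (o i)
  rw [o.norm_eq_one, mul_one] at h
  rw [o.norm_eq_one, one_mul]
  exact h

/-- If `S = R + D` with `‖R‖ ≤ 2 / 3` and `D` of finite rank, then `χ(S)` differs from `tr D` by a
bounded multiple of the logarithmic size of `D`. On the spectral subspace `V` of the large
eigenvalues, `χ(S)` is the trace of `S`, and the trace of `R` there is at most `2 / 3 * dim V`; on
the orthogonal complement the compression of `S` has no large eigenvalue. -/
theorem norm_chi_sub_sum_inner_le [CompleteSpace E] {R : E →L[ℂ] E} (hR : ‖R‖ ≤ 2 / 3) (a b : ι → E)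
    (hb : ∀ y, ∑ j, ‖⟪b j, y⟫_ℂ‖ ^ 2 ≤ 2 * ‖y‖ ^ 2) :
    ‖chi (R + finRankOp a b) - ∑ i, ⟪a i, b i⟫_ℂ‖ ≤ 8 * logSize a := by
  have hfd := finiteDimensional_largeSpace hR a b hb
  set S : E →L[ℂ] E := R + finRankOp a b with hS
  set V := largeSpace (S : End ℂ E) with hV
  have hinv : ∀ x ∈ V, S x ∈ V := fun x hx => apply_mem_largeSpace _ hx
  have hdim : (finrank ℂ V : ℝ) ≤ 6 * logSize a :=
    finrank_le_of_le_largeSpace hR a b hb V hinv le_rfl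
  have hR0 : ‖LinearMap.trace ℂ V (compress V R : End ℂ V)‖ ≤ 4 * logSize a := by
    have h1 := (norm_compress_le V R).trans hR
    have h2 : (0 : ℝ) ≤ finrank ℂ V := Nat.cast_nonneg _
    refine (norm_trace_le _).trans ?_
    nlinarith
  have hD1 : ‖∑ i, ⟪Vᗮ.orthogonalProjectionOnto (a i), Vᗮ.orthogonalProjectionOnto (b i)⟫_ℂ‖ ≤
      4 * logSize a := by
    have h := norm_sum_inner_le_of_no_eigenvalue ((norm_compress_le Vᗮ R).trans hR)
      (fun i => Vᗮ.orthogonalProjectionOnto (a i)) (fun i => Vᗮ.orthogonalProjectionOnto (b i))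
      (sum_norm_inner_orthogonalProjection_le Vᗮ hb) (fun c x hc hx => ?_)
    · exact h.trans (by have := logSize_orthogonalProjection_le Vᗮ a; linarith)
    · rw [← compress_finRankOp, ← add_apply, ← compress_add, compress_apply]
        at hx
      have h1 : ((S : End ℂ E) - c • (1 : End ℂ E)) (x : E) ∈ V := by
        have h2 := congrArg Subtype.val hx
        have h3 : Vᗮ.starProjection (S x - c • (x : E)) = 0 := by
          rw [map_sub, map_smul, Submodule.starProjection_eq_self_iff.2 x.2, sub_eq_zero]
          exact h2
        rw [Submodule.starProjection_apply_eq_zero_iff, Submodule.orthogonal_orthogonal] at h3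
        simpa using h3
      have h2 := mem_largeSpace_of_apply_sub_mem hc h1
      exact Subtype.ext (Submodule.disjoint_def.1 V.orthogonal_disjoint _ h2 x.2)
  have hsplit : ∀ i, ⟪a i, b i⟫_ℂ = ⟪V.orthogonalProjectionOnto (a i), V.orthogonalProjectionOnto (b i)⟫_ℂ +
      ⟪Vᗮ.orthogonalProjectionOnto (a i), Vᗮ.orthogonalProjectionOnto (b i)⟫_ℂ := by
    intro i
    have h1 := V.starProjection_add_starProjection_orthogonal (b i)
    conv_lhs => rw [← h1]
    rw [inner_add_right]
    exact congrArg₂ (· + ·)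
      (V.inner_orthogonalProjectionOnto_eq_of_mem_right (V.orthogonalProjectionOnto (b i)) _).symm
      (Vᗮ.inner_orthogonalProjectionOnto_eq_of_mem_right
        (Vᗮ.orthogonalProjectionOnto (b i)) _).symm
  have hchi : chi S = LinearMap.trace ℂ V (compress V R : End ℂ V) +
      ∑ i, ⟪V.orthogonalProjectionOnto (a i), V.orthogonalProjectionOnto (b i)⟫_ℂ := by
    rw [← trace_compress_finRankOp, ← map_add, chi_eq_trace,
      ← ContinuousLinearMap.toLinearMap_add, ← compress_add]
  have hfinal : chi S - ∑ i, ⟪a i, b i⟫_ℂ = LinearMap.trace ℂ V (compress V R : End ℂ V) -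
      ∑ i, ⟪Vᗮ.orthogonalProjectionOnto (a i), Vᗮ.orthogonalProjectionOnto (b i)⟫_ℂ := by
    rw [hchi]
    simp only [hsplit, Finset.sum_add_distrib]
    ring
  rw [hfinal]
  refine (norm_sub_le _ _).trans ?_
  linarith

end

section

variable {E : Type*} [NormedAddCommGroup E] [InnerProductSpace ℂ E]

/-! ### Compact self-adjoint operators -/

/-- The span of all eigenvectors of `A` whose eigenvalue has modulus at least `τ`. -/
def eigenspan (A : End ℂ E) (τ : ℝ) : Submodule ℂ E :=
  ⨆ z : {z : ℂ // τ ≤ ‖z‖}, A.eigenspace z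

theorem eigenspace_le_eigenspan (A : End ℂ E) {τ : ℝ} {z : ℂ} (hz : τ ≤ ‖z‖) :
    A.eigenspace z ≤ eigenspan A τ :=
  le_iSup (fun z : {z : ℂ // τ ≤ ‖z‖} => A.eigenspace z) ⟨z, hz⟩

theorem apply_mem_eigenspan {A : End ℂ E} {τ : ℝ} {x : E} (hx : x ∈ eigenspan A τ) :
    A x ∈ eigenspan A τ := by
  refine Submodule.iSup_induction (fun z : {z : ℂ // τ ≤ ‖z‖} => A.eigenspace z)
    (motive := fun x => A x ∈ eigenspan A τ) hx (fun z x hx => ?_) (by simp)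
    (fun x y hx hy => by rw [map_add]; exact add_mem hx hy)
  rw [End.mem_eigenspace_iff.1 hx]
  exact Submodule.smul_mem _ _ (eigenspace_le_eigenspan A z.2 hx)

theorem le_norm_apply_of_mem_eigenspan {A : End ℂ E} (hA : A.IsSymmetric) {τ : ℝ} (hτ : 0 ≤ τ)
    {x : E} (hx : x ∈ eigenspan A τ) : τ * ‖x‖ ≤ ‖A x‖ := by
  obtain ⟨v, hv, rfl⟩ := (Submodule.mem_iSup_iff_exists_finsupp _ _).1 hx
  have hfam := hA.orthogonalFamily_eigenspaces.comp
    (Subtype.val_injective (p := fun z : ℂ => τ ≤ ‖z‖))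
  let l : ∀ z : {z : ℂ // τ ≤ ‖z‖}, A.eigenspace z := fun z => ⟨v z, hv z⟩
  have h1 := hfam.norm_sum l v.support
  have h2 := hfam.norm_sum (fun z => (z : ℂ) • l z) v.support
  have h3 : A (v.sum fun _ x => x) = ∑ z ∈ v.support, (z : ℂ) • v z := by
    rw [Finsupp.sum, map_sum]
    exact Finset.sum_congr rfl fun z _ => End.mem_eigenspace_iff.1 (hv z)
  have h4 : ‖v.sum fun _ x => x‖ ^ 2 = ∑ z ∈ v.support, ‖v z‖ ^ 2 := h1
  have h5 : ‖A (v.sum fun _ x => x)‖ ^ 2 = ∑ z ∈ v.support, ‖(z : ℂ) • v z‖ ^ 2 := by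
    rw [h3]; exact h2
  refine le_of_sq_le_sq ?_ (norm_nonneg _)
  rw [mul_pow, h4, h5, Finset.mul_sum]
  refine Finset.sum_le_sum fun z _ => ?_
  rw [norm_smul, mul_pow]
  have := z.2
  gcongr

/-- Eigenvectors of a compact self-adjoint operator with eigenvalues away from `0` span a
finite-dimensional space: the operator is bounded below there, while a finite-dimensional space
approximates its image of the unit ball. -/
theorem finiteDimensional_eigenspan {A : E →L[ℂ] E} (hA : A.IsSymmetric)
    (hc : IsCompactOperator A) {τ : ℝ} (hτ : 0 < τ) :
    FiniteDimensional ℂ (eigenspan (A : End ℂ E) τ) := by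
  obtain ⟨K, hK, hKs⟩ := IsCompactOperator.image_closedBall_subset_compact (f := (A : E →ₗ[ℂ] E))
    hc 1
  obtain ⟨t, -, htf, htK⟩ := hK.finite_cover_balls (e := τ / 2) (by positivity)
  let F := Submodule.span ℂ t
  have hF : FiniteDimensional ℂ F := FiniteDimensional.span_of_finite ℂ htf
  let L : eigenspan (A : End ℂ E) τ →ₗ[ℂ] F :=
    (F.orthogonalProjectionOnto ∘L A ∘L (eigenspan (A : End ℂ E) τ).subtypeL : _ →L[ℂ] F)
  refine FiniteDimensional.of_injective L ?_
  rw [← LinearMap.ker_eq_bot, LinearMap.ker_eq_bot']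
  intro w hw
  by_contra hw0
  have hn : 0 < ‖(w : E)‖ := norm_pos_iff.2 (by simpa using hw0)
  let u : E := ((‖(w : E)‖⁻¹ : ℝ) : ℂ) • (w : E)
  have hu : ‖u‖ = 1 := by
    rw [norm_smul, Complex.norm_real, norm_inv, norm_norm, inv_mul_cancel₀ hn.ne']
  have huW : u ∈ eigenspan (A : End ℂ E) τ := Submodule.smul_mem _ _ w.2
  have hlow : τ * ‖u‖ ≤ ‖A u‖ := le_norm_apply_of_mem_eigenspan hA hτ.le huW
  rw [hu, mul_one] at hlow
  have hperp : A u ∈ Fᗮ := by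
    have h1 : F.orthogonalProjectionOnto (A w) = 0 := hw
    have h2 : A (w : E) ∈ Fᗮ := (Submodule.orthogonalProjectionOnto_eq_zero_iff).1 h1
    simp only [u, map_smul]
    exact Submodule.smul_mem _ _ h2
  have hAu : A u ∈ K := hKs ⟨u, by simp [hu], rfl⟩
  obtain ⟨y, hy, hyd⟩ := Set.mem_iUnion₂.1 (htK hAu)
  rw [Metric.mem_ball, dist_eq_norm] at hyd
  have horth : ⟪y, A u⟫_ℂ = 0 := hperp y (Submodule.subset_span hy)
  have hpy : ‖A u‖ * ‖A u‖ ≤ ‖A u - y‖ * ‖A u - y‖ := by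
    have := norm_sub_sq (𝕜 := ℂ) (A u) y
    rw [inner_eq_zero_symm.1 horth] at this
    simp only [map_zero, mul_zero, sub_zero] at this
    nlinarith [sq_nonneg ‖y‖]
  have := (mul_self_le_mul_self_iff (norm_nonneg _) (norm_nonneg _)).2 hpy
  linarith

theorem finite_setOf_eigenvalue {A : E →L[ℂ] E} (hA : A.IsSymmetric)
    (hc : IsCompactOperator A) {τ : ℝ} (hτ : 0 < τ) :
    {z : ℂ | τ ≤ ‖z‖ ∧ End.HasEigenvalue (A : End ℂ E) z}.Finite := by
  have := finiteDimensional_eigenspan hA hc hτ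
  set Z := {z : ℂ | τ ≤ ‖z‖ ∧ End.HasEigenvalue (A : End ℂ E) z}
  have hex : ∀ z : Z, ∃ x, End.HasEigenvector (A : End ℂ E) z x := fun z =>
    z.2.2.exists_hasEigenvector
  choose x hx using hex
  have hli : LinearIndependent ℂ x := End.eigenvectors_linearIndependent (A : End ℂ E) Z x hx
  let y : Z → eigenspan (A : End ℂ E) τ := fun z =>
    ⟨x z, eigenspace_le_eigenspan _ z.2.1 (hx z).1⟩
  have hli' : LinearIndependent ℂ y := LinearIndependent.of_comp (Submodule.subtype _) hli
  exact hli'.finite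

/-- A compact self-adjoint operator has norm at most `τ` on the orthogonal complement of its
eigenvectors with eigenvalues of modulus at least `τ`. -/
theorem norm_apply_le_of_mem_orthogonal [CompleteSpace E] {A : E →L[ℂ] E} (hA : A.IsSymmetric)
    (hc : IsCompactOperator A) {τ : ℝ} (hτ : 0 < τ) {y : E}
    (hy : y ∈ (eigenspan (A : End ℂ E) τ)ᗮ) : ‖A y‖ ≤ τ * ‖y‖ := by
  set W := eigenspan (A : End ℂ E) τ with hW
  have hinv : ∀ x ∈ Wᗮ, (A : End ℂ E) x ∈ Wᗮ := by
    intro x hx w hw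
    have h1 : ⟪(A : End ℂ E) w, x⟫_ℂ = 0 := hx _ (apply_mem_eigenspan hw)
    rw [← h1]
    exact (hA w x).symm
  let B : Wᗮ →L[ℂ] Wᗮ := A.restrict hinv
  have hBc : IsCompactOperator B := hc.restrict' hinv
  have hBs : B.IsSymmetric := hA.restrict_invariant hinv
  have hB : ‖B‖ ≤ τ := by
    by_contra! hlt
    have hnt : Nontrivial Wᗮ := by
      by_contra hnt
      rw [not_nontrivial_iff_subsingleton] at hnt
      have : ‖B‖ ≤ 0 := B.opNorm_le_bound le_rfl fun x => by
        rw [Subsingleton.elim (B x) 0]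
        simp
      linarith
    obtain ⟨z, hz, hzr⟩ := spectrum.exists_nnnorm_eq_spectralRadius B
    rw [B.spectralRadius_eq_nnnorm hBs.isSelfAdjoint, ENNReal.coe_inj] at hzr
    have hzn : ‖z‖ = ‖B‖ := congrArg NNReal.toReal hzr
    have hz0 : z ≠ 0 := by
      rintro rfl
      rw [norm_zero] at hzn
      linarith
    obtain ⟨x, hx, hx0⟩ :=
      ((hBc.hasEigenvalue_iff_mem_spectrum hz0).2 hz).exists_hasEigenvector
    rw [End.mem_eigenspace_iff] at hx
    have h1 : (A : End ℂ E) (x : E) = z • (x : E) := congrArg Subtype.val hx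
    have h2 : (x : E) ∈ W :=
      eigenspace_le_eigenspan _ (by rw [hzn]; exact hlt.le) (End.mem_eigenspace_iff.2 h1)
    exact hx0 (Subtype.ext (Submodule.disjoint_def.1 W.orthogonal_disjoint _ h2 x.2))
  have h := (B.le_opNorm ⟨y, hy⟩).trans (mul_le_mul_of_nonneg_right hB (norm_nonneg _))
  exact h

/-! ### The absolute value and singular values -/

section absOp

variable [CompleteSpace E] (T : E →L[ℂ] E)

theorem absOp_isPositive : (absOp T).IsPositive :=
  (ContinuousLinearMap.nonneg_iff_isPositive _).1 (CFC.sqrt_nonneg _)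

theorem absOp_isSymmetric : (absOp T).IsSymmetric := (absOp_isPositive T).1

theorem inner_absOp_absOp (x y : E) : ⟪absOp T x, absOp T y⟫_ℂ = ⟪T x, T y⟫_ℂ := by
  have h1 : absOp T * absOp T = ContinuousLinearMap.adjoint T * T :=
    CFC.sqrt_mul_sqrt_self _ (star_mul_self_nonneg T)
  have h2 : ⟪absOp T x, absOp T y⟫_ℂ = ⟪x, absOp T (absOp T y)⟫_ℂ :=
    absOp_isSymmetric T x (absOp T y)
  have h3 := congrArg (fun A : E →L[ℂ] E => A y) h1
  simp only [mul_apply_eq_comp] at h3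
  rw [h2, h3, ContinuousLinearMap.adjoint_inner_right]

theorem norm_absOp_apply (x : E) : ‖absOp T x‖ = ‖T x‖ := by
  rw [norm_eq_sqrt_re_inner (𝕜 := ℂ), norm_eq_sqrt_re_inner (𝕜 := ℂ) (T x), inner_absOp_absOp]

variable {T}

/-- `|T|` is compact, because `T x ↦ |T| x` is an isometry from the range of `T`. -/
theorem absOp_isCompactOperator (hT : IsCompactOperator T) : IsCompactOperator (absOp T) := by
  have h1 := IsCompactOperator.isCompact_closure_image_closedBall (f := (T : E →ₗ[ℂ] E)) hT 1
  refine (isCompactOperator_iff_isCompact_closure_image_closedBall (absOp T : E →ₗ[ℂ] E)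
    one_pos).2 ?_
  have htb : TotallyBounded (T '' Metric.closedBall 0 1) :=
    h1.totallyBounded.subset subset_closure
  refine TotallyBounded.isCompact_of_isClosed ?_ isClosed_closure
  refine TotallyBounded.closure (Metric.totallyBounded_iff.2 fun ε hε => ?_)
  obtain ⟨t, hts, htf, hcov⟩ := totallyBounded_iff_subset.1 htb _ (Metric.dist_mem_uniformity hε)
  obtain ⟨u, -, huf, hu⟩ : ∃ u ⊆ Metric.closedBall (0 : E) 1, u.Finite ∧ t = T '' u :=
    Set.exists_subset_image_finite_and.1 ⟨t, hts, htf, rfl⟩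
  refine ⟨absOp T '' u, huf.image _, ?_⟩
  rintro _ ⟨x, hx, rfl⟩
  obtain ⟨y, hy, hxy⟩ := Set.mem_iUnion₂.1 (hcov ⟨x, hx, rfl⟩)
  rw [hu] at hy
  obtain ⟨v, hv, rfl⟩ := hy
  refine Set.mem_iUnion₂.2 ⟨_, ⟨v, hv, rfl⟩, ?_⟩
  have hxy' : dist (T x) (T v) < ε := hxy
  rw [dist_eq_norm, ← map_sub] at hxy'
  rw [Metric.mem_ball, dist_eq_norm]
  change ‖absOp T x - absOp T v‖ < ε
  rwa [← map_sub, norm_absOp_apply]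

open scoped ComplexOrder in
theorem eq_norm_of_absOp_eigenvalue {z : ℂ} (hz : End.HasEigenvalue (absOp T : End ℂ E) z) :
    z = (‖z‖ : ℂ) := by
  obtain ⟨x, hx, hx0⟩ := hz.exists_hasEigenvector
  rw [End.mem_eigenspace_iff] at hx
  have hx' : absOp T x = z • x := hx
  have h1 : (0 : ℂ) ≤ ⟪x, absOp T x⟫_ℂ := (absOp_isPositive T).inner_nonneg_right x
  rw [hx', inner_smul_right, inner_self_eq_norm_sq_to_K] at h1
  have hn : (0 : ℝ) < ‖x‖ ^ 2 := by have := norm_pos_iff.2 hx0; positivity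
  have h2 : (0 : ℂ) ≤ z := by
    have h3 : z = z * ((‖x‖ : ℂ) ^ 2) * (((‖x‖ ^ 2)⁻¹ : ℝ) : ℂ) := by
      have : (‖x‖ : ℂ) ≠ 0 := by exact_mod_cast (norm_pos_iff.2 hx0).ne'
      push_cast
      field_simp
    rw [h3]
    exact mul_nonneg h1 (by exact_mod_cast (inv_pos.2 hn).le)
  exact (Complex.eq_coe_norm_of_nonneg h2)

theorem algMult_two_smul_absOp (z : ℂ) :
    algMult ((2 : ℂ) • absOp T) (2 * z) = finrank ℂ (End.eigenspace (absOp T : End ℂ E) z) := by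
  have hs : (((2 : ℂ) • absOp T : E →L[ℂ] E) : End ℂ E).IsSymmetric := by
    intro x y
    have h := absOp_isSymmetric T x y
    change ⟪(2 : ℂ) • absOp T x, y⟫_ℂ = ⟪x, (2 : ℂ) • absOp T y⟫_ℂ
    rw [inner_smul_left, inner_smul_right]
    change (starRingEnd ℂ) 2 * ⟪(absOp T : End ℂ E) x, y⟫_ℂ = _
    rw [h, Complex.conj_ofNat]
    rfl
  rw [algMult, hs.isFinitelySemisimple.maxGenEigenspace_eq_eigenspace]
  suffices h : End.eigenspace (((2 : ℂ) • absOp T : E →L[ℂ] E) : End ℂ E) (2 * z) =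
      End.eigenspace (absOp T : End ℂ E) z by rw [h]
  ext x
  rw [End.mem_eigenspace_iff, End.mem_eigenspace_iff]
  change (2 : ℂ) • absOp T x = (2 * z) • x ↔ absOp T x = z • x
  rw [mul_smul, smul_right_inj (two_ne_zero)]

/-- `μ(2|T|)` dominates every finite sum of `log 2s` over singular values `s`, counted with
multiplicity. The sum defining `μ(2|T|)` has finite support, so that it is not a junk value. -/
theorem sum_finrank_mul_log_le_mu (hT : IsCompactOperator T) (Z : Finset ℂ) :
    ∑ z ∈ Z, (finrank ℂ (End.eigenspace (absOp T : End ℂ E) z) : ℝ) * Real.log (2 * ‖z‖) ≤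
      mu ((2 : ℂ) • absOp T) := by
  classical
  have hfin := finite_setOf_eigenvalue (absOp_isSymmetric T) (absOp_isCompactOperator hT)
    (τ := 1 / 2) (by norm_num)
  set F : ℂ → ℝ := fun z => (algMult ((2 : ℂ) • absOp T) z : ℝ) * Real.posLog ‖z‖ with hF
  have hsupp : Function.support F ⊆ ↑((hfin.toFinset ∪ Z).image fun z => 2 * z) := by
    intro z hz
    have hz2 : 2 * (z / 2) = z := mul_div_cancel₀ z two_ne_zero
    rw [Finset.mem_coe, Finset.mem_image]
    refine ⟨z / 2, Finset.mem_union_left _ ?_, hz2⟩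
    rw [Set.Finite.mem_toFinset]
    constructor
    · by_contra! hlt
      refine hz ?_
      rw [norm_div] at hlt
      norm_num at hlt
      have : Real.posLog ‖z‖ = 0 := by
        rw [Real.posLog_eq_zero_iff, abs_of_nonneg (norm_nonneg z)]
        linarith
      simp [hF, this]
    · intro hbot
      refine hz ?_
      have h0 : algMult ((2 : ℂ) • absOp T) z = 0 := by
        conv_lhs => rw [← hz2]
        rw [algMult_two_smul_absOp]
        change finrank ℂ (End.genEigenspace (absOp T : End ℂ E) (z / 2) 1) = 0
        rw [hbot, finrank_bot]
      simp [hF, h0]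
  have hmu : mu ((2 : ℂ) • absOp T) = ∑ z ∈ (hfin.toFinset ∪ Z).image (fun z => 2 * z), F z :=
    finsum_eq_sum_of_support_subset _ hsupp
  rw [hmu, Finset.sum_image (fun x _ y _ h => mul_left_cancel₀ two_ne_zero h)]
  have hle : ∑ z ∈ Z, F (2 * z) ≤ ∑ z ∈ hfin.toFinset ∪ Z, F (2 * z) :=
    Finset.sum_le_sum_of_subset_of_nonneg Finset.subset_union_right fun z _ _ =>
      mul_nonneg (Nat.cast_nonneg _) Real.posLog_nonneg
  refine le_trans (Finset.sum_le_sum fun z hz => ?_) hle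
  simp only [hF]
  rw [algMult_two_smul_absOp, norm_mul, Complex.norm_ofNat]
  exact mul_le_mul_of_nonneg_left (le_max_right _ _) (Nat.cast_nonneg _)

/-- The singular value decomposition of a compact operator, truncated at the singular values below
`2 / 3`. -/
theorem exists_truncated_svd (hT : IsCompactOperator T) :
    ∃ (n : ℕ) (s : Fin n → ℝ) (e f : Fin n → E), Orthonormal ℂ e ∧ Orthonormal ℂ f ∧
      (∀ i, 2 / 3 ≤ s i) ∧ ‖T - finRankOp (fun i => (s i : ℂ) • e i) f‖ ≤ 2 / 3 ∧
      ∑ i, Real.log (2 * s i) ≤ mu ((2 : ℂ) • absOp T) := by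
  classical
  have hc := absOp_isCompactOperator hT
  have hsym := absOp_isSymmetric T
  set A : End ℂ E := (absOp T : End ℂ E) with hAdef
  have hfin := finite_setOf_eigenvalue hsym hc (τ := 2 / 3) (by norm_num)
  set Z := hfin.toFinset with hZ
  have hZm : ∀ z, z ∈ Z ↔ 2 / 3 ≤ ‖z‖ ∧ A.HasEigenvalue z := fun z => by
    rw [hZ, Set.Finite.mem_toFinset]; rfl
  have hWfd := finiteDimensional_eigenspan hsym hc (τ := 2 / 3) (by norm_num)
  have hfd : ∀ z : Z, FiniteDimensional ℂ (A.eigenspace z) := fun z =>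
    Submodule.finiteDimensional_of_le (eigenspace_le_eigenspan A ((hZm z).1 z.2).1)
  let J := Σ z : Z, Fin (finrank ℂ (A.eigenspace (z : ℂ)))
  let o : ∀ z : Z, OrthonormalBasis (Fin (finrank ℂ (A.eigenspace (z : ℂ)))) ℂ
    (A.eigenspace (z : ℂ)) := fun z => stdOrthonormalBasis ℂ _
  let e : J → E := fun i => (o i.1 i.2 : E)
  let s : J → ℝ := fun i => ‖(i.1 : ℂ)‖
  have hs : ∀ i, 2 / 3 ≤ s i := fun i => ((hZm i.1).1 i.1.2).1
  have hs0 : ∀ i, (s i : ℂ) ≠ 0 := fun i => by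
    have := hs i
    exact_mod_cast (by linarith : (0 : ℝ) < s i).ne'
  have he : Orthonormal ℂ e :=
    (hsym.orthogonalFamily_eigenspaces.comp (Subtype.val_injective (p := fun z => z ∈ Z)))
      |>.orthonormal_sigma_orthonormal (v_family := fun z => o z) fun z => (o z).orthonormal
  have hAe : ∀ i, absOp T (e i) = (s i : ℂ) • e i := by
    intro i
    have h1 : A (e i) = (i.1 : ℂ) • e i := End.mem_eigenspace_iff.1 (o i.1 i.2).2
    rw [eq_norm_of_absOp_eigenvalue ((hZm i.1).1 i.1.2).2] at h1
    exact h1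
  -- the left singular vectors
  let f : J → E := fun i => (s i : ℂ)⁻¹ • T (e i)
  have hf : Orthonormal ℂ f := by
    rw [orthonormal_iff_ite] at he ⊢
    intro i j
    simp only [f, inner_smul_left, inner_smul_right, ← inner_absOp_absOp, hAe, he]
    split_ifs with hij
    · subst hij
      have := hs0 i
      simp only [map_inv₀, Complex.conj_ofReal]
      field_simp
    · simp
  have hR : ‖T - finRankOp (fun i => (s i : ℂ) • e i) f‖ ≤ 2 / 3 := by
    refine ContinuousLinearMap.opNorm_le_bound _ (by norm_num) fun x => ?_
    -- the finite rank part is `T` composed with the projection onto the span of the `e i`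
    set y := x - ∑ i, ⟪e i, x⟫_ℂ • e i with hy
    have h1 : (T - finRankOp (fun i => (s i : ℂ) • e i) f) x = T y := by
      rw [sub_apply, finRankOp_apply, hy, map_sub, map_sum]
      congr 1
      refine Finset.sum_congr rfl fun i _ => ?_
      have := hs0 i
      simp only [f, inner_smul_left, Complex.conj_ofReal, map_smul, smul_smul]
      congr 1
      field_simp
    have hye : ∀ i, ⟪e i, y⟫_ℂ = 0 := by
      intro i
      rw [hy, inner_sub_right, he.inner_right_fintype, sub_self]
    have hyW : y ∈ (eigenspan A (2 / 3))ᗮ := by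
      intro w hw
      refine Submodule.iSup_induction (fun z : {z : ℂ // 2 / 3 ≤ ‖z‖} => A.eigenspace z)
        (motive := fun w => ⟪w, y⟫_ℂ = 0) hw (fun z w hw => ?_) (by simp)
        (fun u v hu hv => by rw [inner_add_left, hu, hv, add_zero])
      rcases eq_or_ne w 0 with rfl | hw0
      · simp
      have hz : (z : ℂ) ∈ Z := (hZm _).2 ⟨z.2, End.hasEigenvalue_of_hasEigenvector ⟨hw, hw0⟩⟩
      have h2 := congrArg Subtype.val ((o ⟨z, hz⟩).sum_repr' ⟨w, hw⟩)
      rw [← show _ = w from h2, Submodule.coe_sum, sum_inner]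
      refine Finset.sum_eq_zero fun k _ => ?_
      have h3 : ⟪((o ⟨z, hz⟩ k : A.eigenspace (z : ℂ)) : E), y⟫_ℂ = 0 := hye ⟨⟨z, hz⟩, k⟩
      rw [Submodule.coe_smul, inner_smul_left, h3, mul_zero]
    have hyx : ‖y‖ ≤ ‖x‖ := by
      have h2 : ⟪∑ i, ⟪e i, x⟫_ℂ • e i, y⟫_ℂ = 0 := by
        rw [sum_inner]
        exact Finset.sum_eq_zero fun i _ => by rw [inner_smul_left, hye, mul_zero]
      have h3 := norm_add_sq_eq_norm_sq_add_norm_sq_of_inner_eq_zero _ _ h2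
      rw [hy, add_sub_cancel, ← hy] at h3
      exact (mul_self_le_mul_self_iff (norm_nonneg _) (norm_nonneg _)).2
        (by rw [h3]; exact le_add_of_nonneg_left (mul_self_nonneg _))
    rw [h1, ← norm_absOp_apply]
    refine (norm_apply_le_of_mem_orthogonal hsym hc (by norm_num) hyW).trans ?_
    gcongr
  have hlog : ∑ i, Real.log (2 * s i) ≤ mu ((2 : ℂ) • absOp T) := by
    refine le_trans (le_of_eq ?_) (sum_finrank_mul_log_le_mu hT Z)
    rw [Fintype.sum_sigma, ← Finset.sum_coe_sort Z]
    refine Finset.sum_congr rfl fun z _ => ?_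
    simp only [s, Finset.sum_const, Finset.card_univ, Fintype.card_fin, nsmul_eq_mul]
    rfl
  let g := (Fintype.equivFin J).symm
  refine ⟨Fintype.card J, s ∘ g, e ∘ g, f ∘ g, he.comp _ g.injective, hf.comp _ g.injective,
    fun i => hs _, ?_, ?_⟩
  · have h1 : finRankOp (fun i => ((s ∘ g) i : ℂ) • (e ∘ g) i) (f ∘ g) =
        finRankOp (fun i => (s i : ℂ) • e i) f := by
      ext x
      rw [finRankOp_apply, finRankOp_apply]
      exact g.sum_comp fun i => ⟪(s i : ℂ) • e i, x⟫_ℂ • f i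
    rw [h1]
    exact hR
  · rw [← g.sum_comp] at hlog
    exact hlog

end absOp

end

section

variable {E : Type*} [NormedAddCommGroup E] [InnerProductSpace ℂ E] [CompleteSpace E]

/-! ### Linear combinations of an operator and its adjoint -/

theorem adjoint_finRankOp {ι : Type*} [Fintype ι] (a b : ι → E) :
    ContinuousLinearMap.adjoint (finRankOp a b) = finRankOp b a := by
  symm
  rw [ContinuousLinearMap.eq_adjoint_iff]
  intro x y
  simp only [finRankOp_apply, sum_inner, inner_sum, inner_smul_left, inner_smul_right,
    inner_conj_symm]
  exact Finset.sum_congr rfl fun i _ => mul_comm _ _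

theorem log_one_add_le {s : ℝ} (hs : 2 / 3 ≤ s) :
    Real.log (1 + 12 * s) ≤ 8 * Real.log (2 * s) := by
  have h : 1 + 12 * s ≤ (2 * s) ^ 8 := by
    -- `2 s ≥ 4 / 3` and `(4 / 3) ^ 7 > 7`
    have h1 : (4 / 3 : ℝ) ^ 7 ≤ (2 * s) ^ 7 := by gcongr; linarith
    have h2 : (2 * s) ^ 8 = (2 * s) ^ 7 * (2 * s) := by ring
    rw [h2]
    nlinarith
  have := Real.log_le_log (by linarith) h
  rwa [Real.log_pow] at this

/-- For `|α| + |β| ≤ 1`, the sum `χ(α T + β T*)` is `α t + β conj t` up to a multiple of `μ(2|T|)`,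
where `t` is the trace of a finite rank operator that depends on `T` only. -/
theorem exists_norm_chi_sub_le {T : E →L[ℂ] E} (hT : IsCompactOperator T) :
    ∃ t : ℂ, ∀ α β : ℂ, ‖α‖ + ‖β‖ ≤ 1 →
      ‖chi (α • T + β • ContinuousLinearMap.adjoint T) - (α * t + β * conj t)‖ ≤
        128 * mu ((2 : ℂ) • absOp T) := by
  obtain ⟨n, s, e, f, he, hf, hs, hR, hlog⟩ := exists_truncated_svd hT
  refine ⟨∑ i, (s i : ℂ) * ⟪e i, f i⟫_ℂ, fun α β hαβ => ?_⟩
  set D : E →L[ℂ] E := finRankOp (fun i => (s i : ℂ) • e i) f with hD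
  let a : Fin n ⊕ Fin n → E := Sum.elim (fun i => conj α • (s i : ℂ) • e i)
    (fun i => conj β • (s i : ℂ) • f i)
  let b : Fin n ⊕ Fin n → E := Sum.elim f e
  -- `D` and its adjoint, together, are one finite rank operator with `2 n` terms
  set R : E →L[ℂ] E := α • (T - D) + β • ContinuousLinearMap.adjoint (T - D) with hRdef
  have hab : finRankOp a b = α • D + β • ContinuousLinearMap.adjoint D := by
    rw [hD, adjoint_finRankOp]
    ext x
    rw [finRankOp_apply, Fintype.sum_sum_type]
    simp only [a, b, Sum.elim_inl, Sum.elim_inr, add_apply, FunLike.coe_smul, Pi.smul_apply,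
      finRankOp_apply, Finset.smul_sum, inner_smul_left, map_mul, RCLike.conj_conj,
      Complex.conj_ofReal, smul_smul]
    congr 1 <;> exact Finset.sum_congr rfl fun i _ => by congr 1; ring
  have hS : α • T + β • ContinuousLinearMap.adjoint T = R + finRankOp a b := by
    rw [hab, hRdef, map_sub, smul_sub, smul_sub]
    abel
  have hRn : ‖R‖ ≤ 2 / 3 := by
    refine (norm_add_le _ _).trans ?_
    rw [norm_smul, norm_smul, LinearIsometryEquiv.norm_map]
    nlinarith [norm_nonneg (T - D), norm_nonneg α, norm_nonneg β]
  have hb : ∀ y, ∑ j, ‖⟪b j, y⟫_ℂ‖ ^ 2 ≤ 2 * ‖y‖ ^ 2 := by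
    intro y
    rw [Fintype.sum_sum_type]
    have h1 := hf.sum_inner_products_le y (s := Finset.univ)
    have h2 := he.sum_inner_products_le y (s := Finset.univ)
    simp only [b, Sum.elim_inl, Sum.elim_inr]
    linarith
  have ht : ∑ i, ⟪a i, b i⟫_ℂ = α * (∑ i, (s i : ℂ) * ⟪e i, f i⟫_ℂ) +
      β * conj (∑ i, (s i : ℂ) * ⟪e i, f i⟫_ℂ) := by
    rw [Fintype.sum_sum_type, map_sum, Finset.mul_sum, Finset.mul_sum]
    simp only [a, b, Sum.elim_inl, Sum.elim_inr, inner_smul_left, RCLike.conj_conj,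
      Complex.conj_ofReal, map_mul, inner_conj_symm]
  have hsize : logSize a ≤ 16 * mu ((2 : ℂ) • absOp T) := by
    have key : ∀ (c : ℂ) (v : Fin n → E), Orthonormal ℂ v → ‖c‖ ≤ 1 →
        ∑ i, Real.log (1 + 12 * ‖conj c • (s i : ℂ) • v i‖) ≤ 8 * ∑ i, Real.log (2 * s i) := by
      intro c v hv hc
      rw [Finset.mul_sum]
      refine Finset.sum_le_sum fun i _ => ?_
      have hsi : 0 ≤ s i := by have := hs i; linarith
      refine le_trans (Real.log_le_log (by positivity) ?_) (log_one_add_le (hs i))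
      rw [norm_smul, norm_smul, hv.1, RCLike.norm_conj, Complex.norm_real, Real.norm_eq_abs,
        abs_of_nonneg hsi]
      nlinarith
    have h1 := key α e he (by linarith [norm_nonneg β])
    have h2 := key β f hf (by linarith [norm_nonneg α])
    rw [logSize, Fintype.sum_sum_type]
    simp only [a, Sum.elim_inl, Sum.elim_inr]
    linarith
  rw [hS, ← ht]
  refine (norm_chi_sub_sum_inner_le hRn a b hb).trans ?_
  linarith

end

end CompactOp

theorem theorem2p7 :
    ∃ C₂ : ℝ, ∀ (𝓗 : Type*) [NormedAddCommGroup 𝓗] [InnerProductSpace ℂ 𝓗] [CompleteSpace 𝓗]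
      [TopologicalSpace.SeparableSpace 𝓗] (T H K : 𝓗 →L[ℂ] 𝓗),
      IsCompactOperator T →
      H = (1 / 2 : ℂ) • (T + ContinuousLinearMap.adjoint T) →
      K = (1 / (2 * Complex.I) : ℂ) • (T - ContinuousLinearMap.adjoint T) →
      ‖CompactOp.chi H - ((CompactOp.chi T).re : ℂ)‖
          ≤ C₂ * CompactOp.mu ((2 : ℂ) • CompactOp.absOp T) ∧
      ‖CompactOp.chi K - ((CompactOp.chi T).im : ℂ)‖
          ≤ C₂ * CompactOp.mu ((2 : ℂ) • CompactOp.absOp T) := by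
  refine ⟨256, fun 𝓗 _ _ _ _ T H K hT hH hK => ?_⟩
  obtain ⟨t, ht⟩ := CompactOp.exists_norm_chi_sub_le hT
  have hT0 := ht 1 0 (by simp)
  simp only [one_smul, zero_smul, add_zero, one_mul, zero_mul] at hT0
  constructor
  · have h := ht (1 / 2) (1 / 2) (by norm_num)
    rw [← smul_add, ← hH, ← mul_add, Complex.add_conj] at h
    have h1 : (1 / 2 : ℂ) * ((2 * t.re : ℝ) : ℂ) = (t.re : ℂ) := by push_cast; ring
    rw [h1] at h
    have h2 : ‖((t.re : ℂ) - ((CompactOp.chi T).re : ℂ))‖ ≤ ‖CompactOp.chi T - t‖ := by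
      rw [← Complex.ofReal_sub, ← Complex.sub_re, Complex.norm_real, norm_sub_rev]
      exact Complex.abs_re_le_norm _
    have h3 := norm_sub_le_norm_sub_add_norm_sub (CompactOp.chi H) (t.re : ℂ)
      ((CompactOp.chi T).re : ℂ)
    linarith
  · have h := ht (1 / (2 * Complex.I)) (-(1 / (2 * Complex.I))) (by norm_num)
    rw [neg_smul, ← sub_eq_add_neg, ← smul_sub, ← hK, neg_mul, ← sub_eq_add_neg, ← mul_sub,
      Complex.sub_conj] at h
    have h1 : (1 / (2 * Complex.I) : ℂ) * (((2 * t.im : ℝ) : ℂ) * Complex.I) = (t.im : ℂ) := by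
      have := Complex.I_ne_zero
      push_cast
      field_simp
    rw [h1] at h
    have h2 : ‖((t.im : ℂ) - ((CompactOp.chi T).im : ℂ))‖ ≤ ‖CompactOp.chi T - t‖ := by
      rw [← Complex.ofReal_sub, ← Complex.sub_im, Complex.norm_real, norm_sub_rev]
      exact Complex.abs_im_le_norm _
    have h3 := norm_sub_le_norm_sub_add_norm_sub (CompactOp.chi K) (t.im : ℂ)
      ((CompactOp.chi T).im : ℂ)
    linarith
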